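/- **Model.** Let $\ell\ge 2$, $\ell\mid n$, $\varepsilon\in(0,1/2)$, $\lg=\log_2$. A set of $n$ vertices is distributed over $\ell$ servers, each of capacity $(1+\varepsilon)n/\ell$; initially every server holds exactly $n/\ell$ vertices. An unknown communication graph whose connected components all have size $n/\ell$ is revealed online by a finite sequence of its edges (requests), whose union has the same connected components as the graph. A request costs $1$ if its endpoints are on different servers when it arrives, and moving a vertex to another server costs $\alpha>1$. Loads must never exceed the capacities, and at the end the sets of vertices on the servers must be exactly the connected components. $\mathrm{OFF}$ is the minimum cost of a solution that knows the whole input in advance, and $M$ is the number of vertex moves of such an optimal solution. In a *distributed* algorithm each server initially knows $n$, $\ell$, $\varepsilon$, its own ID (the servers have the IDs $0,\dots,\ell-1$; server $0$ is the root) and its own vertices. The servers have a shared clock and all-to-all communication in synchronous rounds, and unlimited local computational power. A request is seen only by the servers that host its endpoints, who also learn each other's ID; the next request arrives when no message is in transit. Each message has $O(\lg n)$ bits, and a vertex is moved by a message from its current host that carries it; these messages are counted as well. **Theorem.** There are absolute constants $B,c,C>0$ and numbers $K_a$ depending only on $a>0$ such that for all $n,\ell,\varepsilon$ as above there is a deterministic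 distributed algorithm, with messages of at most $B\lg n$ payload bits, which on every input terminates, never exceeds the capacities, ends with exactly one connected component on each server, and satisfies the following. * For every $\alpha>1$ its total cost is at most $C\,\dfrac{\ell\,\lg n\,\lg\ell}{\varepsilon}\cdot\mathrm{OFF}$. * If $M\le c\,\dfrac{\varepsilon n}{\ell\lg\ell}$, it sends at most $C\,M\lg n$ messages. * If $M> c\,\dfrac{\varepsilon n}{\ell\lg\ell}$, it sends at most $C\left(\dfrac{\ell^2\lg n}{\varepsilon}+n\lg n+\dfrac{M\,\ell\lg n}{\varepsilon}\right)$ messages. (Since $M\le\mathrm{OFF}$, the same holds with $\mathrm{OFF}$ in place of $M$.) * For every $a>0$: if $\ell\le a\sqrt{\varepsilon n}$, then the number of messages it sends is at most $K_a$ times the number of its vertex moves; that is, its communication is asymptotically at most its cost for moving vertices. -/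

import Mathlib

namespace OnlinePartition

/-- An assignment of the `n` vertices to the `ℓ` servers. -/
abbrev Assignment (n ℓ : ℕ) : Type := Fin n → Fin ℓ

/-- The number of vertices assigned to server `j`. -/
def load {n ℓ : ℕ} (a : Assignment n ℓ) (j : Fin ℓ) : ℕ :=
  (Finset.univ.filter fun v => a v = j).card

/-- Every server has load at most its capacity `(1 + ε) n / ℓ`. -/
def Valid {n ℓ : ℕ} (ε : ℝ) (a : Assignment n ℓ) : Prop :=
  ∀ j, (load a j : ℝ) ≤ (1 + ε) * n / ℓ

/-- Every server has load exactly `n / ℓ`. -/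
def PerfectlyBalanced {n ℓ : ℕ} (a : Assignment n ℓ) : Prop :=
  ∀ j, load a j * ℓ = n

/-- The number of vertices that change their server between `a` and `b`. -/
def numMoved {n ℓ : ℕ} (a b : Assignment n ℓ) : ℕ :=
  (Finset.univ.filter fun v => a v ≠ b v).card

/-- Communication cost of a request: one unit if its endpoints are on different servers. -/
def commCost {n ℓ : ℕ} (a : Assignment n ℓ) (e : Fin n × Fin n) : ℕ :=
  if a e.1 = a e.2 then 0 else 1

/-- The graph whose edges are the requests in the list `σ`. -/
def revealedGraph {n : ℕ} (σ : List (Fin n × Fin n)) : SimpleGraph (Fin n) :=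
  SimpleGraph.fromRel fun u v => (u, v) ∈ σ

/-- An input: a communication graph whose connected components (the ground truth components)
all have size `n / ℓ`, a perfectly balanced initial assignment, and a sequence of edges of the
graph that reveals the ground truth components. -/
structure Instance (n ℓ : ℕ) where
  graph : SimpleGraph (Fin n)
  component_card : ∀ c : graph.ConnectedComponent, c.supp.ncard * ℓ = n
  init : Assignment n ℓ
  init_balanced : PerfectlyBalanced init
  requests : List (Fin n × Fin n)
  requests_adj : ∀ e ∈ requests, graph.Adj e.1 e.2
  reveals : ∀ u v, (revealedGraph requests).Reachable u v ↔ graph.Reachable u v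

/-- The vertex sets on the servers are exactly the ground truth components. -/
def Instance.IsPerfectPartitioning {n ℓ : ℕ} (I : Instance n ℓ) (a : Assignment n ℓ) : Prop :=
  Set.range (fun j : Fin ℓ => {v | a v = j}) =
    Set.range (fun c : I.graph.ConnectedComponent => c.supp)

/-! ### Offline solutions -/

/-- An offline solution, chosen with full knowledge of the input. `pos t` is the assignment when
request number `t` (counted from `0`) arrives; `pos r`, with `r` the number of requests, is the
final assignment. Vertices may also be moved before the first request. -/
structure OfflineSchedule {n ℓ : ℕ} (I : Instance n ℓ) (ε : ℝ) where
  pos : ℕ → Assignment n ℓ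
  valid : ∀ t ≤ I.requests.length, Valid ε (pos t)
  final : I.IsPerfectPartitioning (pos I.requests.length)

namespace OfflineSchedule

variable {n ℓ : ℕ} {I : Instance n ℓ} {ε : ℝ}

/-- The number of vertex moves. -/
def moves (O : OfflineSchedule I ε) : ℕ :=
  numMoved I.init (O.pos 0) +
    ∑ t ∈ Finset.range I.requests.length, numMoved (O.pos t) (O.pos (t + 1))

/-- The total communication cost. -/
def comm (O : OfflineSchedule I ε) : ℕ :=
  ∑ t : Fin I.requests.length, commCost (O.pos t) (I.requests.get t)

/-- Communication cost plus `α` for every vertex move. -/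
def cost (O : OfflineSchedule I ε) (α : ℝ) : ℝ := O.comm + α * O.moves

/-- `O` is a solution of minimum cost, i.e. one of the optimal offline algorithm. -/
def IsOptimal (O : OfflineSchedule I ε) (α : ℝ) : Prop :=
  ∀ O' : OfflineSchedule I ε, O.cost α ≤ O'.cost α

end OfflineSchedule

/-! ### Distributed online algorithms -/

/-- A message. Its payload has `B * log₂ n` bits. A vertex is moved to another server by a message
that carries it. -/
structure Message (n ℓ B : ℕ) where
  dest : Fin ℓ
  vertex : Option (Fin n)
  payload : Fin (n ^ B)

/-- What the servers that host an endpoint of a request get to see when the endpoints communicate: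
the request and the IDs of the hosts of its two endpoints. -/
structure Notice (n ℓ : ℕ) where
  edge : Fin n × Fin n
  hosts : Fin ℓ × Fin ℓ

/-- A deterministic distributed algorithm for `ℓ` servers with arbitrary local computations.
Server `j` starts with its ID and the set of vertices it hosts initially. In each synchronous round
it reads the shared clock, its local state, possibly the notice of a request that has an endpoint on
it, and the messages it was sent in the previous round together with their senders; it computes its
new state and the messages it sends. Any server may send to any other. -/
structure DistributedAlgorithm (n ℓ B : ℕ) where
  State : Type
  start : Fin ℓ → Finset (Fin n) → State
  step : Fin ℓ → ℕ → State → Option (Notice n ℓ) → List (Fin ℓ × Message n ℓ B) →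
    State × List (Message n ℓ B)

namespace DistributedAlgorithm

variable {n ℓ B : ℕ}

/-- A global configuration, with the messages and vertex moves counted so far. `outbox i` holds the
messages that server `i` sent in the last round. -/
structure Config (A : DistributedAlgorithm n ℓ B) where
  clock : ℕ
  loc : Assignment n ℓ
  state : Fin ℓ → A.State
  outbox : Fin ℓ → List (Message n ℓ B)
  pending : List (Fin n × Fin n)
  messages : ℕ
  moves : ℕ
  comm : ℕ

variable {A : DistributedAlgorithm n ℓ B}

/-- The messages that reach server `j`, ordered by sender. -/
def Config.inbox (c : A.Config) (j : Fin ℓ) : List (Fin ℓ × Message n ℓ B) :=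
  (List.finRange ℓ).flatMap fun i =>
    ((c.outbox i).filter fun m => m.dest = j).map fun m => (i, m)

/-- A request is shown to the hosts of its endpoints only. -/
def Config.notice (c : A.Config) (req : Option (Fin n × Fin n)) (j : Fin ℓ) :
    Option (Notice n ℓ) :=
  match req with
  | none => none
  | some e =>
    if c.loc e.1 = j ∨ c.loc e.2 = j then some ⟨e, (c.loc e.1, c.loc e.2)⟩ else none

/-- The local step of server `j`. -/
def Config.localStep (c : A.Config) (req : Option (Fin n × Fin n)) (j : Fin ℓ) :
    A.State × List (Message n ℓ B) :=
  A.step j c.clock (c.state j) (c.notice req j) (c.inbox j)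

/-- The assignment after the round: only the current host of `v` can move `v`, by a message that
carries it. If it tries to send `v` more than once in the round, the first message counts. -/
def Config.newLoc (c : A.Config) (req : Option (Fin n × Fin n)) : Assignment n ℓ := fun v =>
  match (c.localStep req (c.loc v)).2.find? (fun m => m.vertex = some v) with
  | some m => m.dest
  | none => c.loc v

/-- One synchronous round, in which the request `req` (if any) arrives. -/
def Config.round (c : A.Config) (req : Option (Fin n × Fin n)) : A.Config where
  clock := c.clock + 1
  loc := c.newLoc req
  state := fun j => (c.localStep req j).1
  outbox := fun j => (c.localStep req j).2
  pending := c.pending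
  messages := c.messages + ∑ j, (c.localStep req j).2.length
  moves := c.moves + numMoved c.loc (c.newLoc req)
  comm := c.comm + (match req with
    | none => 0
    | some e => commCost c.loc e)

/-- No message is in transit. -/
def Config.Idle (c : A.Config) : Prop := ∀ j, c.outbox j = []

/-- All requests have been processed. -/
def Config.Finished (c : A.Config) : Prop := c.Idle ∧ c.pending = []

open Classical in
/-- The next request arrives as soon as no message is in transit any more. A finished configuration
does not change. -/
noncomputable def Config.next (c : A.Config) : A.Config :=
  if c.Idle then
    match c.pending with
    | [] => c
    | e :: rest => Config.round { c with pending := rest } (some e)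
  else c.round none

/-- The configuration at the start on input `I`: server `j` knows its ID and its own vertices. -/
def initial (A : DistributedAlgorithm n ℓ B) (I : Instance n ℓ) : A.Config where
  clock := 0
  loc := I.init
  state := fun j => A.start j (Finset.univ.filter fun v => I.init v = j)
  outbox := fun _ => []
  pending := I.requests
  messages := 0
  moves := 0
  comm := 0

/-- The configuration after `t` rounds on input `I`. -/
noncomputable def run (A : DistributedAlgorithm n ℓ B) (I : Instance n ℓ) (t : ℕ) : A.Config :=
  Config.next^[t] (A.initial I)

/-- Communication cost for requests plus `α` for every vertex move. -/
def Config.cost (c : A.Config) (α : ℝ) : ℝ := c.comm + α * c.moves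

end DistributedAlgorithm

end OnlinePartition

namespace OnlinePartition

/-! ### Labelled pieces -/

section Classes

variable {n ℓ : ℕ}

/-! The requests seen so far cut the vertices into pieces, the label classes. Each piece lies on one
server and inside one ground truth component. For the analysis alone, fix a perfectly balanced
assignment `f` that keeps components together and is as close as possible to the initial one, at
distance D. Every offline solution ends in a candidate for `f`, so it makes at least D moves. It
therefore suffices to bound the moves of the algorithm in terms of D. Every paid request moves at
least one vertex, and messages are charged to moves.

Decentralized phase: the two hosts compare statistics, and the smaller piece joins the larger one,
except that a server that is home to more than 7/8 of the union attracts it. So a piece never sits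
away from a server that is home to more than 7/8 of it. If `f` puts the piece elsewhere than the
algorithm does, then `f` moves at least 1/8 of its vertices. This gives O(D log n) moves
(`MajorityInv.join`, `MajorityInv.sum_le`) and loads of at most n/ℓ + 8D (`MajorityInv.load_le`).
Consequently an overload proves D > εn/(8ℓ) (`MajorityInv.overload`), and for smaller D the root is
never needed.

Centralized phase: after an overload the root collects all data and decides alone. Smaller pieces
join larger ones; if the result does not fit, the root installs a perfectly balanced assignment of
whole pieces closest to the initial one, which is at distance at most D because `f` competes. The
sum of the logarithms of the piece sizes rises with each merge by at least the size of the smaller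
piece and never exceeds n log n. Between two recomputations it rises by more than εn/ℓ, so there are
at most ℓ log n / ε of them, each costing O(D) beyond what the potential pays
(`CentralInv.recompute`, `CentralInv.moves_bound`). Since n < 8Dℓ/ε in this phase, the total is O(D
ℓ log n / ε).

Messages: opening the centralized phase takes O(n) messages. They are paid for because this
rearrangement is chosen so as to move at least half of all vertices (`reset_spec`). A merge inside a
server then costs one message and uses up one label; any other request costs a bounded number of
messages per move. So messages are at most 11 times the moves on every input.

The remaining work shows that the message-passing rounds carry out these steps (`Shape` describes a
configuration, `IdleInv` holds between requests). -/

/-- The sum of `g` over the vertices that carry the same label as `x`. -/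
def classSum (L : Fin n → Fin n) (g : Fin n → ℕ) (x : Fin n) : ℕ :=
  ∑ y, if L y = L x then g y else 0

/-- The number of vertices that carry the same label as `x`. -/
def classSize (L : Fin n → Fin n) (x : Fin n) : ℕ := classSum L (fun _ => 1) x

/-- The number of vertices with the label of `x` that are at home on server `h`. -/
def homeCount (init : Assignment n ℓ) (L : Fin n → Fin n) (x : Fin n) (h : Fin ℓ) : ℕ :=
  classSum L (fun y => if init y = h then 1 else 0) x

/-- The class of `a` is given the label of `b`. -/
def relabel (L : Fin n → Fin n) (a b : Fin n) : Fin n → Fin n :=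
  fun w => if L w = L a then L b else L w

/-- The class of `a` is moved to the server of `b`. -/
def shift (loc : Assignment n ℓ) (L : Fin n → Fin n) (a b : Fin n) : Assignment n ℓ :=
  fun w => if L w = L a then loc b else loc w

/-- Vertices with the same label are on the same server. -/
def Consistent (L : Fin n → Fin n) (f : Assignment n ℓ) : Prop :=
  ∀ x y, L x = L y → f x = f y

theorem classSum_congr (L : Fin n → Fin n) (g : Fin n → ℕ) {x y : Fin n} (h : L x = L y) :
    classSum L g x = classSum L g y := by
  simp only [classSum, h]

theorem classSize_congr (L : Fin n → Fin n) {x y : Fin n} (h : L x = L y) :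
    classSize L x = classSize L y :=
  classSum_congr L _ h

theorem classSum_relabel_of_mem {L : Fin n → Fin n} {a b : Fin n} (hab : L a ≠ L b)
    (g : Fin n → ℕ) {x : Fin n} (hx : L x = L a ∨ L x = L b) :
    classSum (relabel L a b) g x = classSum L g a + classSum L g b := by
  have hx' : relabel L a b x = L b := by
    unfold relabel; rcases hx with h | h <;> simp [h]
  simp only [classSum, hx', ← Finset.sum_add_distrib]
  refine Finset.sum_congr rfl fun y _ => ?_
  unfold relabel
  by_cases h1 : L y = L a
  · simp [h1, hab]
  · simp [h1]

theorem classSum_relabel_of_not_mem {L : Fin n → Fin n} {a b : Fin n}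
    (g : Fin n → ℕ) {x : Fin n} (hxa : L x ≠ L a) (hxb : L x ≠ L b) :
    classSum (relabel L a b) g x = classSum L g x := by
  simp only [classSum, relabel, hxa, if_false]
  refine Finset.sum_congr rfl fun y _ => ?_
  by_cases h1 : L y = L a
  · simp [h1, Ne.symm hxa, Ne.symm hxb]
  · simp [h1]

theorem classSum_add (L : Fin n → Fin n) (g g' : Fin n → ℕ) (x : Fin n) :
    classSum L (fun y => g y + g' y) x = classSum L g x + classSum L g' x := by
  simp only [classSum, ← Finset.sum_add_distrib]
  exact Finset.sum_congr rfl fun y _ => by split_ifs <;> simp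

theorem classSum_congr_fun (L : Fin n → Fin n) {g g' : Fin n → ℕ} {x : Fin n}
    (h : ∀ y, L y = L x → g y = g' y) : classSum L g x = classSum L g' x := by
  refine Finset.sum_congr rfl fun y _ => ?_
  split_ifs with hy
  · exact h y hy
  · rfl

theorem classSum_mono (L : Fin n → Fin n) {g g' : Fin n → ℕ} {x : Fin n}
    (h : ∀ y, L y = L x → g y ≤ g' y) : classSum L g x ≤ classSum L g' x := by
  refine Finset.sum_le_sum fun y _ => ?_
  split_ifs with hy
  · exact h y hy
  · rfl

/-- The classes partition the vertices, so bounds proved piece by piece add up to global ones. -/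
theorem sum_le_of_classSum_le {L : Fin n → Fin n} {g g' : Fin n → ℕ} {K : ℕ}
    (h : ∀ x, classSum L g x ≤ K * classSum L g' x) : ∑ y, g y ≤ K * ∑ y, g' y := by
  rw [← Finset.sum_fiberwise Finset.univ L g, ← Finset.sum_fiberwise Finset.univ L g',
    Finset.mul_sum]
  refine Finset.sum_le_sum fun l _ => ?_
  by_cases hl : ∃ x, L x = l
  · obtain ⟨x, rfl⟩ := hl
    simpa [classSum, Finset.sum_filter] using h x
  · have : Finset.univ.filter (fun y => L y = l) = ∅ := by
      ext y; simpa using fun hy => hl ⟨y, hy⟩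
    simp [this]

theorem classSize_eq_card (L : Fin n → Fin n) (x : Fin n) :
    classSize L x = (Finset.univ.filter fun y => L y = L x).card := by
  simp [classSize, classSum]

theorem classSize_pos (L : Fin n → Fin n) (x : Fin n) : 0 < classSize L x := by
  rw [classSize_eq_card]
  exact Finset.card_pos.2 ⟨x, by simp⟩

theorem classSize_le (L : Fin n → Fin n) (x : Fin n) : classSize L x ≤ n := by
  rw [classSize_eq_card]
  exact (Finset.card_le_univ _).trans (by simp)

theorem homeCount_add_le (init : Assignment n ℓ) (L : Fin n → Fin n) (x : Fin n) {h j : Fin ℓ}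
    (hj : h ≠ j) : homeCount init L x h + homeCount init L x j ≤ classSize L x := by
  rw [homeCount, homeCount, ← classSum_add]
  refine classSum_mono L fun y _ => ?_
  by_cases h1 : init y = h
  · simp [h1, hj]
  · simp only [h1, if_false]; split_ifs <;> simp

theorem homeCount_le (init : Assignment n ℓ) (L : Fin n → Fin n) (x : Fin n) (h : Fin ℓ) :
    homeCount init L x h ≤ classSize L x :=
  classSum_mono L fun y _ => by split_ifs <;> simp

/-- `f` is constant on a piece, so a vertex of the piece stays under `f` exactly when its home is
that one server. This turns majority statements into lower bounds on the moves of `f`. -/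
theorem classSum_ne_add_homeCount (init f : Assignment n ℓ) {L : Fin n → Fin n}
    (hf : Consistent L f) (x : Fin n) :
    classSum L (fun y => if init y ≠ f y then 1 else 0) x + homeCount init L x (f x) =
      classSize L x := by
  rw [homeCount, ← classSum_add]
  refine classSum_congr_fun L fun y hy => ?_
  rw [hf y x hy]
  by_cases h : init y = f x <;> simp [h]

theorem numMoved_eq_sum (a b : Assignment n ℓ) :
    numMoved a b = ∑ y, if a y ≠ b y then 1 else 0 := by
  rw [numMoved, Finset.card_filter]

theorem Consistent.of_relabel {L : Fin n → Fin n} {a b : Fin n} {f : Assignment n ℓ}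
    (hf : Consistent (relabel L a b) f) : Consistent L f := fun x y h =>
  hf x y (by simp only [relabel, h])

theorem Consistent.relabel {L : Fin n → Fin n} {a b : Fin n} {f : Assignment n ℓ}
    (hf : Consistent L f) (h : f a = f b) : Consistent (relabel L a b) f := by
  intro x y hxy
  unfold OnlinePartition.relabel at hxy
  split_ifs at hxy with h1 h2 h2
  · exact (hf x a h1).trans (hf y a h2).symm
  · rw [hf x a h1, h, hf b y hxy]
  · rw [hf x b hxy, ← h, hf y a h2]
  · exact hf x y hxy

theorem Consistent.shift {L : Fin n → Fin n} {a b : Fin n} {loc : Assignment n ℓ}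
    (hf : Consistent L loc) :
    Consistent (OnlinePartition.relabel L a b) (shift loc L a b) := by
  intro x y hxy
  unfold OnlinePartition.relabel at hxy
  unfold OnlinePartition.shift
  split_ifs at hxy ⊢ with h1 h2 h2
  · rfl
  · exact hf b y hxy
  · exact hf x b hxy
  · exact hf x y hxy

theorem numMoved_shift {loc : Assignment n ℓ} {L : Fin n → Fin n} (hc : Consistent L loc)
    {a b : Fin n} (h : loc a ≠ loc b) :
    numMoved loc (shift loc L a b) = classSize L a := by
  rw [classSize_eq_card, numMoved]
  congr 1
  ext w
  simp only [Finset.mem_filter, Finset.mem_univ, true_and]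
  unfold shift
  split_ifs with hw
  · simp [hw, hc w a hw, h]
  · simp [hw]

theorem load_shift_self {loc : Assignment n ℓ} {L : Fin n → Fin n} (hc : Consistent L loc)
    {a b : Fin n} (h : loc a ≠ loc b) :
    load (shift loc L a b) (loc b) = load loc (loc b) + classSize L a := by
  rw [classSize_eq_card, load, load, ← Finset.card_union_of_disjoint]
  · congr 1
    ext w
    simp only [Finset.mem_filter, Finset.mem_univ, true_and, Finset.mem_union]
    unfold shift
    split_ifs with hw <;> simp [hw]
  · rw [Finset.disjoint_filter]
    intro w _ h1 h2
    exact h ((hc w a h2).symm.trans h1)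

theorem load_shift_of_ne (loc : Assignment n ℓ) (L : Fin n → Fin n) {a b : Fin n} {j : Fin ℓ}
    (hj : j ≠ loc b) : load (shift loc L a b) j ≤ load loc j := by
  refine Finset.card_le_card fun w => ?_
  simp only [Finset.mem_filter, Finset.mem_univ, true_and]
  unfold shift
  split_ifs with hw
  · intro h; exact absurd h.symm hj
  · exact id

theorem numMoved_comm (a b : Assignment n ℓ) : numMoved a b = numMoved b a := by
  simp only [numMoved, ne_comm]

theorem numMoved_triangle (a b c : Assignment n ℓ) :
    numMoved a c ≤ numMoved a b + numMoved b c := by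
  refine le_trans (Finset.card_le_card fun v => ?_) (Finset.card_union_le _ _)
  simp only [Finset.mem_filter, Finset.mem_univ, true_and, Finset.mem_union]
  intro h
  by_contra! h'
  exact h (h'.1.trans h'.2)

theorem numMoved_le (a b : Assignment n ℓ) : numMoved a b ≤ n :=
  (Finset.card_le_univ _).trans (by simp)

@[simp] theorem numMoved_self (a : Assignment n ℓ) : numMoved a a = 0 := by
  simp [numMoved]

end Classes

/-! ### The decentralized phase -/

section Majority

variable {n ℓ : ℕ}

/-- The rule by which the class of `a` joins the class of `b`: the home server of `b` has a large
majority in the union, or that of `a` does not and `a` has the smaller class. -/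
def Joins (init loc : Assignment n ℓ) (L : Fin n → Fin n) (a b : Fin n) : Prop :=
  7 * (classSize L a + classSize L b) <
      8 * (homeCount init L a (loc b) + homeCount init L b (loc b)) ∨
    8 * (homeCount init L a (loc a) + homeCount init L b (loc a)) ≤
        7 * (classSize L a + classSize L b) ∧ classSize L a ≤ classSize L b

/-- The invariant of the decentralized phase. `w v` counts the moves of vertex `v`; `f` is any
assignment in which the pieces are collocated. -/
structure MajorityInv (init : Assignment n ℓ) (f : Assignment n ℓ) (loc : Assignment n ℓ)
    (L : Fin n → Fin n) (w : Fin n → ℕ) : Prop where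
  coll : Consistent L loc
  maj : ∀ x h, h ≠ loc x → 8 * homeCount init L x h ≤ 7 * classSize L x
  small : ∀ x, classSum L w x + 4 * classSize L x ≤
    5 * (classSize L x * Nat.log 2 (classSize L x)) + 4 * homeCount init L x (loc x)
  few : ∀ x, classSum L w x ≤
    80 * (classSum L (fun y => if init y ≠ f y then 1 else 0) x * Nat.log 2 (classSize L x))

/-- For singletons at home the logarithm vanishes and `small` reads 4 ≤ 4. In general `small` says
that the moves of a piece, plus a credit of 4 for each vertex away from home, are at most 5 s log s
for a piece of size s. -/
theorem MajorityInv.initial (init f : Assignment n ℓ) : MajorityInv init f init id 0 where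
  coll := fun x y h => by rw [show x = y from h]
  maj := fun x h hh => by simp [homeCount, classSum, Ne.symm hh]
  small := fun x => by simp [homeCount, classSum, classSize]
  few := fun x => by simp [classSum]

/-- Every element of the smaller part ends in a set at least twice as large, so its logarithm gains
1. -/
theorem mul_log_add_le {p q : ℕ} (hp : 0 < p) (hpq : p ≤ q) :
    p * Nat.log 2 p + p + q * Nat.log 2 q ≤ (p + q) * Nat.log 2 (p + q) := by
  have h1 : Nat.log 2 p + 1 ≤ Nat.log 2 (p + q) := by
    rw [← Nat.log_mul_base (by norm_num) hp.ne']
    exact Nat.log_mono_right (by omega)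
  have h2 : Nat.log 2 q ≤ Nat.log 2 (p + q) := Nat.log_mono_right (by omega)
  nlinarith

theorem mul_log_add_min_le {p q : ℕ} (hp : 0 < p) (hq : 0 < q) :
    p * Nat.log 2 p + min p q + q * Nat.log 2 q ≤ (p + q) * Nat.log 2 (p + q) := by
  rcases le_total p q with h | h
  · rw [min_eq_left h]; exact mul_log_add_le hp h
  · rw [min_eq_right h]
    have := mul_log_add_le hq h
    rw [add_comm q p] at this
    omega

/-- Two pieces on the same server are merged. -/
theorem MajorityInv.merge {init f loc : Assignment n ℓ} {L : Fin n → Fin n} {w : Fin n → ℕ}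
    (hi : MajorityInv init f loc L w) {a b : Fin n} (hab : L a ≠ L b) (hloc : loc a = loc b) :
    MajorityInv init f loc (relabel L a b) w where
  coll := hi.coll.relabel hloc
  maj := fun x h hh => by
    by_cases hx : L x = L a ∨ L x = L b
    · have hxa : loc x = loc a := by
        rcases hx with hx | hx
        · exact hi.coll x a hx
        · rw [hi.coll x b hx, hloc]
      simp only [classSize, homeCount, classSum_relabel_of_mem hab _ hx]
      have := hi.maj a h (hxa ▸ hh)
      have := hi.maj b h (hloc ▸ hxa ▸ hh)
      simp only [classSize, homeCount] at *
      omega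
    · push Not at hx
      simp only [classSize, homeCount, classSum_relabel_of_not_mem _ hx.1 hx.2]
      exact hi.maj x h hh
  small := fun x => by
    by_cases hx : L x = L a ∨ L x = L b
    · have hxa : loc x = loc a := by
        rcases hx with hx | hx
        · exact hi.coll x a hx
        · rw [hi.coll x b hx, hloc]
      have h1 := hi.small a
      have h2 := hi.small b
      have h3 := mul_log_add_min_le (classSize_pos L a) (classSize_pos L b)
      simp only [classSize, homeCount, classSum_relabel_of_mem hab _ hx, hxa] at *
      rw [← hloc] at h2
      omega
    · push Not at hx
      simp only [classSize, homeCount, classSum_relabel_of_not_mem _ hx.1 hx.2]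
      exact hi.small x
  few := fun x => by
    by_cases hx : L x = L a ∨ L x = L b
    · have h1 := hi.few a
      have h2 := hi.few b
      have h3 : Nat.log 2 (classSize L a) ≤ Nat.log 2 (classSize L a + classSize L b) :=
        Nat.log_mono_right (by omega)
      have h4 : Nat.log 2 (classSize L b) ≤ Nat.log 2 (classSize L a + classSize L b) :=
        Nat.log_mono_right (by omega)
      simp only [classSize, classSum_relabel_of_mem hab _ hx] at *
      refine (add_le_add h1 h2).trans ?_
      rw [add_mul, mul_add]
      gcongr
    · push Not at hx
      simp only [classSize, classSum_relabel_of_not_mem _ hx.1 hx.2]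
      exact hi.few x

theorem shift_apply_of_mem {loc : Assignment n ℓ} {L : Fin n → Fin n} (hc : Consistent L loc)
    {a b x : Fin n} (hx : L x = L a ∨ L x = L b) : shift loc L a b x = loc b := by
  unfold shift
  split_ifs with h
  · rfl
  · exact hc x b (hx.resolve_left h)

/-- A piece is moved to the server of another one and merged with it. -/
theorem MajorityInv.join {init f loc : Assignment n ℓ} {L : Fin n → Fin n} {w : Fin n → ℕ}
    (hi : MajorityInv init f loc L w) {a b : Fin n} (hab : L a ≠ L b) (hloc : loc a ≠ loc b)
    (hf : Consistent L f) (hfab : f a = f b) (hj : Joins init loc L a b) :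
    MajorityInv init f (shift loc L a b) (relabel L a b)
      (fun y => w y + if L y = L a then 1 else 0) := by
  have hwa : classSum L (fun y => w y + if L y = L a then 1 else 0) a =
      classSum L w a + classSize L a := by
    rw [classSum_add]; congr 1
    exact classSum_congr_fun L fun y hy => by simp [hy]
  have hwb : classSum L (fun y => w y + if L y = L a then 1 else 0) b = classSum L w b := by
    exact classSum_congr_fun L fun y hy => by simp [hy, hab.symm]
  -- If the smaller piece moves, each of its vertices costs 1 for the move and at most 4 in new
  -- credit, which the gain 5 min pays; this fixes the 5. If the larger piece moves, the target
  -- server is home to over 7/8 of the union, so enough vertices return home for their released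
  -- credit, together with that gain, to pay for the moves.
  have hsmall : classSum L w a + classSize L a + classSum L w b +
      4 * (classSize L a + classSize L b) ≤
      5 * ((classSize L a + classSize L b) * Nat.log 2 (classSize L a + classSize L b)) +
      4 * (homeCount init L a (loc b) + homeCount init L b (loc b)) := by
    have h1 := hi.small a
    have h2 := hi.small b
    have h3 := mul_log_add_min_le (classSize_pos L a) (classSize_pos L b)
    have h4 := homeCount_add_le init L a hloc
    have h5 := homeCount_add_le init L b hloc
    rcases le_or_gt (classSize L a) (classSize L b) with hle | hlt
    · rw [min_eq_left hle] at h3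
      have := homeCount_le init L a (loc a)
      omega
    · rw [min_eq_right hlt.le] at h3
      rcases hj with hj | hj
      · omega
      · omega
  refine ⟨hi.coll.shift, ?_, ?_, ?_⟩
  · intro x h hh
    by_cases hx : L x = L a ∨ L x = L b
    · rw [shift_apply_of_mem hi.coll hx] at hh
      have e1 : classSize (relabel L a b) x = classSize L a + classSize L b :=
        classSum_relabel_of_mem hab _ hx
      have e2 : homeCount init (relabel L a b) x h = homeCount init L a h + homeCount init L b h :=
        classSum_relabel_of_mem hab _ hx
      rw [e1, e2]
      have hb := hi.maj b h hh
      by_cases hha : h = loc a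
      · subst hha
        rcases hj with hj | hj
        · have h4 := homeCount_add_le init L a hloc
          have h5 := homeCount_add_le init L b hloc
          omega
        · exact hj.1
      · have ha := hi.maj a h hha
        omega
    · push Not at hx
      have : shift loc L a b x = loc x := by simp [shift, hx.1]
      rw [this] at hh
      simp only [classSize, homeCount, classSum_relabel_of_not_mem _ hx.1 hx.2]
      exact hi.maj x h hh
  · intro x
    by_cases hx : L x = L a ∨ L x = L b
    · rw [shift_apply_of_mem hi.coll hx]
      have e1 : classSize (relabel L a b) x = classSize L a + classSize L b :=
        classSum_relabel_of_mem hab _ hx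
      have e2 : homeCount init (relabel L a b) x (loc b) =
        homeCount init L a (loc b) + homeCount init L b (loc b) :=
        classSum_relabel_of_mem hab _ hx
      rw [e1, e2, classSum_relabel_of_mem hab _ hx, hwa, hwb]
      exact hsmall
    · push Not at hx
      have : shift loc L a b x = loc x := by simp [shift, hx.1]
      rw [this]
      simp only [classSize, homeCount, classSum_relabel_of_not_mem _ hx.1 hx.2]
      rw [classSum_congr_fun L (g' := w) fun y hy => by simp [hy, hx.1]]
      exact hi.small x
  · intro x
    by_cases hx : L x = L a ∨ L x = L b
    · have e1 : classSize (relabel L a b) x = classSize L a + classSize L b :=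
        classSum_relabel_of_mem hab _ hx
      rw [e1, classSum_relabel_of_mem hab _ hx, classSum_relabel_of_mem hab _ hx, hwa, hwb]
      have na := classSum_ne_add_homeCount init f hf a
      have nb := classSum_ne_add_homeCount init f hf b
      have pa := classSize_pos L a
      have pb := classSize_pos L b
      set na' := classSum L (fun y => if init y ≠ f y then 1 else 0) a
      set nb' := classSum L (fun y => if init y ≠ f y then 1 else 0) b
      -- When `f` moves at least 1/16 of the union, the crude bound 5 s log s from `hsmall`
      -- suffices: 80 = 5 · 16.
      have bad : classSize L a + classSize L b ≤ 16 * (na' + nb') →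
          classSum L w a + classSize L a + classSum L w b ≤ 80 * ((na' + nb') *
            Nat.log 2 (classSize L a + classSize L b)) := by
        intro hbad
        have h4 := homeCount_le init L a (loc b)
        have h5 := homeCount_le init L b (loc b)
        have := Nat.mul_le_mul_right (Nat.log 2 (classSize L a + classSize L b)) hbad
        rw [mul_assoc] at this
        omega
      rcases le_or_gt (classSize L a) (classSize L b) with hle | hlt
      -- Here `f` agrees with the target, hence not with the old place of `a`. By `maj` it moves at
      -- least 1/8 of the class of `a`, and the logarithm of that class grows by 1, which pays for
      -- the new moves.
      · by_cases hfb : f b = loc b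
        · have hfa : f a ≠ loc a := by rw [hfab, hfb]; exact hloc.symm
          have h1 := hi.maj a (f a) hfa
          have h2 : _ ≤ 80 * (na' * _) := hi.few a
          have h3 : _ ≤ 80 * (nb' * _) := hi.few b
          have h4 : Nat.log 2 (classSize L a) + 1 ≤
              Nat.log 2 (classSize L a + classSize L b) := by
            rw [← Nat.log_mul_base (by norm_num) pa.ne']
            exact Nat.log_mono_right (by omega)
          have h5 : Nat.log 2 (classSize L b) ≤ Nat.log 2 (classSize L a + classSize L b) :=
            Nat.log_mono_right (by omega)
          have h6 := Nat.mul_le_mul_left na' h4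
          have h7 := Nat.mul_le_mul_left nb' h5
          rw [add_mul]
          rw [mul_add, mul_one] at h6
          omega
        -- `f` moves at least 1/8 of the class of `b`, the larger one, hence at least 1/16 of the
        -- union.
        · apply bad
          have h1 := hi.maj b (f b) hfb
          omega
      -- The larger piece moves only under a 7/8 majority at the target. Either `f` agrees with the
      -- target and so moves 1/8 of the larger piece, or it moves at least that majority.
      · have hj' := hj.resolve_right (by omega)
        apply bad
        by_cases hfb : f b = loc b
        · have hfa : f a ≠ loc a := by rw [hfab, hfb]; exact hloc.symm
          have h1 := hi.maj a (f a) hfa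
          omega
        · have h1 := homeCount_add_le init L a (hfab ▸ hfb : f a ≠ loc b)
          have h2 := homeCount_add_le init L b hfb
          omega
    · push Not at hx
      simp only [classSize, classSum_relabel_of_not_mem _ hx.1 hx.2]
      rw [classSum_congr_fun L (g' := w) fun y hy => by simp [hy, hx.1]]
      exact hi.few x

theorem MajorityInv.sum_le {init f loc : Assignment n ℓ} {L : Fin n → Fin n} {w : Fin n → ℕ}
    (hi : MajorityInv init f loc L w) : ∑ v, w v ≤ 80 * (numMoved init f * Nat.log 2 n) := by
  rw [numMoved_eq_sum, mul_comm _ (Nat.log 2 n), ← mul_assoc]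
  refine sum_le_of_classSum_le (L := L) fun x => (hi.few x).trans ?_
  rw [mul_assoc, mul_comm (Nat.log 2 n)]
  gcongr
  exact classSize_le L x

/-- The excess load consists of guests. A piece placed where `f` wants it has only guests that `f`
moves as well; a piece placed elsewhere has, by `maj`, at least 1/8 of its vertices moved by `f`. -/
theorem MajorityInv.load_le {init f loc : Assignment n ℓ} {L : Fin n → Fin n} {w : Fin n → ℕ}
    (hi : MajorityInv init f loc L w) (hf : Consistent L f) (j : Fin ℓ) :
    load loc j ≤ load init j + 8 * numMoved init f := by
  have h : ∑ y, (if loc y = j ∧ init y ≠ j then 1 else 0) ≤ 8 * numMoved init f := by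
    rw [numMoved_eq_sum]
    refine sum_le_of_classSum_le (L := L) fun x => ?_
    by_cases hx : loc x = j
    · have e : classSum L (fun y => if loc y = j ∧ init y ≠ j then 1 else 0) x +
          homeCount init L x j = classSize L x := by
        rw [homeCount, ← classSum_add]
        refine classSum_congr_fun L fun y hy => ?_
        rw [hi.coll y x hy]
        by_cases h : init y = j <;> simp [h, hx]
      have nx := classSum_ne_add_homeCount init f hf x
      by_cases hfx : f x = j
      · rw [hfx] at nx; omega
      · have := hi.maj x (f x) (hx ▸ hfx)
        have := homeCount_le init L x j
        omega
    · rw [classSum_congr_fun L (g' := fun _ => 0) fun y hy => by simp [hi.coll y x hy, hx]]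
      simp [classSum]
  refine le_trans ?_ (Nat.add_le_add_left h _)
  rw [← Finset.card_filter, load, load]
  refine le_trans (Finset.card_le_card fun v => ?_) (Finset.card_union_le _ _)
  simp only [Finset.mem_filter, Finset.mem_univ, true_and, Finset.mem_union]
  tauto

end Majority

/-! ### The centralized phase -/

section Central

variable {n ℓ : ℕ}

/-- The total of the logarithms of the sizes of the pieces, over all vertices. -/
def potential (L : Fin n → Fin n) : ℕ := ∑ v, Nat.log 2 (classSize L v)

theorem potential_le (L : Fin n → Fin n) : potential L ≤ n * Nat.log 2 n := by
  refine (Finset.sum_le_card_nsmul _ _ (Nat.log 2 n) fun v _ =>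
    Nat.log_mono_right (classSize_le L v)).trans ?_
  simp

/-- The class of every vertex of the smaller piece at least doubles, so each of them contributes 1;
no other logarithm falls. -/
theorem potential_add_le {L : Fin n → Fin n} {a b : Fin n} (hab : L a ≠ L b) :
    potential L + min (classSize L a) (classSize L b) ≤ potential (relabel L a b) := by
  have pa := classSize_pos L a
  have pb := classSize_pos L b
  have key : ∀ c, (c = a ∨ c = b) → (∀ d, d = a ∨ d = b → classSize L c ≤ classSize L d) →
      potential L + classSize L c ≤ potential (relabel L a b) := by
    intro c hc hmin
    rw [classSize_eq_card, Finset.card_filter, potential, potential, ← Finset.sum_add_distrib]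
    refine Finset.sum_le_sum fun v _ => ?_
    by_cases hv : L v = L a ∨ L v = L b
    · have e1 : classSize (relabel L a b) v = classSize L a + classSize L b :=
        classSum_relabel_of_mem hab _ hv
      rw [e1]
      split_ifs with h
      · rw [classSize_congr L h, ← Nat.log_mul_base (by norm_num) (classSize_pos L c).ne']
        refine Nat.log_mono_right ?_
        have := hmin a (Or.inl rfl)
        have := hmin b (Or.inr rfl)
        omega
      · rw [add_zero]
        refine Nat.log_mono_right ?_
        rcases hv with hv | hv <;> rw [classSize_congr L hv] <;> omega
    · have hvc : L v ≠ L c := by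
        rcases hc with rfl | rfl
        · exact fun h => hv (Or.inl h)
        · exact fun h => hv (Or.inr h)
      push Not at hv
      have e1 : classSize (relabel L a b) v = classSize L v :=
        classSum_relabel_of_not_mem _ hv.1 hv.2
      rw [e1, if_neg hvc, add_zero]
  rcases le_total (classSize L a) (classSize L b) with h | h
  · rw [min_eq_left h]
    refine key a (Or.inl rfl) ?_
    rintro d (rfl | rfl)
    · rfl
    · exact h
  · rw [min_eq_right h]
    refine key b (Or.inr rfl) ?_
    rintro d (rfl | rfl)
    · exact h
    · rfl

/-- The invariant of the centralized phase: `prev` is the result of the last of `R`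
recomputations, at which the potential was `s`. -/
structure CentralInv (ε : ℝ) (init loc : Assignment n ℓ) (L : Fin n → Fin n)
    (base M moves : ℕ) (prev : Assignment n ℓ) (R s : ℕ) : Prop where
  coll : Consistent L loc
  load_le : ∀ j, (load loc j : ℝ) ≤ n / ℓ + (potential L - s)
  dist : numMoved loc prev + s ≤ potential L
  rounds : R * (ε * n / ℓ) ≤ s
  moves_le : moves + numMoved prev init ≤ base + 2 * M * R + potential L + s

theorem PerfectlyBalanced.load_eq {a : Assignment n ℓ} (ha : PerfectlyBalanced a) (hℓ : 0 < ℓ)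
    (j : Fin ℓ) : (load a j : ℝ) = n / ℓ := by
  have : (0 : ℝ) < ℓ := by exact_mod_cast hℓ
  rw [eq_div_iff this.ne']
  exact_mod_cast ha j

theorem PerfectlyBalanced.valid {a : Assignment n ℓ} (ha : PerfectlyBalanced a) (hℓ : 0 < ℓ)
    {ε : ℝ} (hε : 0 < ε) : Valid ε a := by
  intro j
  rw [ha.load_eq hℓ]
  gcongr
  have : (0 : ℝ) ≤ n := Nat.cast_nonneg n
  nlinarith

/-- The opening arrangement serves as the zeroth recomputation. The term `n` in `hm` covers its
distance to `init`, which is not bounded by `M`. -/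
theorem CentralInv.start {ε : ℝ} {init loc : Assignment n ℓ} {L : Fin n → Fin n}
    {base M moves : ℕ} (hℓ : 0 < ℓ) (hc : Consistent L loc) (hb : PerfectlyBalanced loc)
    (hm : moves + n ≤ base) :
    CentralInv ε init loc L base M moves loc 0 (potential L) where
  coll := hc
  load_le := fun j => by rw [hb.load_eq hℓ]; simp
  dist := by simp
  rounds := by simp
  moves_le := by have := numMoved_le loc init; omega

theorem CentralInv.merge {ε : ℝ} {init loc prev : Assignment n ℓ} {L : Fin n → Fin n}
    {base M moves R s : ℕ} (hi : CentralInv ε init loc L base M moves prev R s)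
    {a b : Fin n} (hab : L a ≠ L b) (hloc : loc a = loc b) :
    CentralInv ε init loc (relabel L a b) base M moves prev R s := by
  have hp := potential_add_le hab
  have hp' : (potential L : ℝ) ≤ potential (relabel L a b) := by
    exact_mod_cast (Nat.le_add_right _ _).trans hp
  have h1 := hi.dist
  have h2 := hi.moves_le
  exact ⟨hi.coll.relabel hloc, fun j => (hi.load_le j).trans (by gcongr), by omega, hi.rounds,
    by omega⟩

/-- The size of the moving piece bounds the new load, the new distance to `prev` and the new moves
alike, and the rise of the potential covers it. -/
theorem CentralInv.join {ε : ℝ} {init loc prev : Assignment n ℓ} {L : Fin n → Fin n}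
    {base M moves R s : ℕ} (hi : CentralInv ε init loc L base M moves prev R s)
    {a b : Fin n} (hab : L a ≠ L b) (hloc : loc a ≠ loc b)
    (hle : classSize L a ≤ classSize L b) :
    CentralInv ε init (shift loc L a b) (relabel L a b) base M
      (moves + numMoved loc (shift loc L a b)) prev R s := by
  have hp := potential_add_le hab
  rw [min_eq_left hle] at hp
  have hp' : (potential L : ℝ) + classSize L a ≤ potential (relabel L a b) := by
    exact_mod_cast hp
  have h1 := hi.dist
  have h2 := hi.moves_le
  have h3 := numMoved_triangle (shift loc L a b) loc prev
  rw [numMoved_comm (shift loc L a b) loc] at h3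
  rw [numMoved_shift hi.coll hloc] at h3 ⊢
  refine ⟨hi.coll.shift, fun j => ?_, by omega, hi.rounds, by omega⟩
  by_cases hj : j = loc b
  · rw [hj, load_shift_self hi.coll hloc]
    have := hi.load_le (loc b)
    push_cast
    linarith
  · have h4 : (load (shift loc L a b) j : ℝ) ≤ load loc j := by
      exact_mod_cast load_shift_of_ne loc L hj
    have := hi.load_le j
    have : (0 : ℝ) ≤ classSize L a := Nat.cast_nonneg _
    linarith

/-- The way from `loc` to `g` is bounded via `prev` and `init`. The first leg is paid by the
potential gained since the last recomputation, the second by the stored term `numMoved prev init`,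
the third by `M`; another `M` restores the stored term for `g`, hence 2 `M` per round. By `load_le`,
an overload forces the potential to have risen by more than εn/ℓ since `s`, which advances `rounds`.
-/
theorem CentralInv.recompute {ε : ℝ} {init loc prev g : Assignment n ℓ} {L : Fin n → Fin n}
    {base M moves R s : ℕ} (hi : CentralInv ε init loc L base M moves prev R s) (hℓ : 0 < ℓ)
    {a b : Fin n} (hab : L a ≠ L b) (hle : classSize L a ≤ classSize L b)
    (hfull : (1 + ε) * n / ℓ < load loc (loc b) + classSize L a)
    (hg : Consistent (relabel L a b) g) (hgb : PerfectlyBalanced g)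
    (hgM : numMoved init g ≤ M) :
    CentralInv ε init g (relabel L a b) base M (moves + numMoved loc g) g (R + 1)
      (potential (relabel L a b)) := by
  have hp := potential_add_le hab
  rw [min_eq_left hle] at hp
  have hp' : (potential L : ℝ) + classSize L a ≤ potential (relabel L a b) := by
    exact_mod_cast hp
  have h1 := hi.dist
  have h2 := hi.moves_le
  have h3 := numMoved_triangle loc prev g
  have h4 := numMoved_triangle prev init g
  have h5 := numMoved_comm g init
  refine ⟨hg, fun j => by rw [hgb.load_eq hℓ]; simp, by simp, ?_, ?_⟩
  · have h6 := hi.load_le (loc b)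
    have h7 := hi.rounds
    have h8 : (1 + ε) * n / ℓ = n / ℓ + ε * n / ℓ := by ring
    push_cast
    linarith
  · rw [mul_add]
    omega

/-- Both `potential L` and `s` are at most n log n, so `rounds` limits `R` to ℓ log n / ε. -/
theorem CentralInv.moves_bound {ε : ℝ} {init loc prev : Assignment n ℓ} {L : Fin n → Fin n}
    {base M moves R s : ℕ} (hi : CentralInv ε init loc L base M moves prev R s) (hℓ : 0 < ℓ)
    (hn : 0 < n) (hε : 0 < ε) :
    (moves : ℝ) ≤ base + 2 * (M * (ℓ * Nat.log 2 n / ε)) + 2 * (n * Nat.log 2 n) := by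
  have hℓ' : (0 : ℝ) < ℓ := by exact_mod_cast hℓ
  have hn' : (0 : ℝ) < n := by exact_mod_cast hn
  have h1 : (potential L : ℝ) ≤ n * Nat.log 2 n := by exact_mod_cast potential_le L
  have h2 : (s : ℝ) ≤ potential L := by
    exact_mod_cast (Nat.le_add_left _ _).trans hi.dist
  have h3 : (R : ℝ) ≤ ℓ * Nat.log 2 n / ε := by
    have := hi.rounds
    rw [le_div_iff₀ hε]
    have h4 : R * (ε * n / ℓ) ≤ n * Nat.log 2 n := by linarith
    rw [mul_div_assoc', div_le_iff₀ hℓ'] at h4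
    refine le_of_mul_le_mul_right (a := (n : ℝ)) ?_ hn'
    linarith
  have h5 : (moves : ℝ) + numMoved prev init ≤ base + 2 * M * R + potential L + s := by
    exact_mod_cast hi.moves_le
  have h6 : (M : ℝ) * R ≤ M * (ℓ * Nat.log 2 n / ε) := by gcongr
  have h7 : (0 : ℝ) ≤ numMoved prev init := Nat.cast_nonneg _
  linarith

end Central

/-! ### Choices made by the root -/

section Choices

variable {n ℓ : ℕ}

open Classical in
/-- Some element that satisfies `P`, if there is one. -/
noncomputable def pick {β : Type*} (P : β → Prop) : Option β :=
  if h : ∃ b, P b then some h.choose else none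

theorem pick_eq_some {β : Type*} {P : β → Prop} {b : β} (hb : P b) (hu : ∀ b', P b' → b' = b) :
    pick P = some b := by
  have h : ∃ b, P b := ⟨b, hb⟩
  rw [pick, dif_pos h, hu _ h.choose_spec]

theorem pick_eq_none {β : Type*} {P : β → Prop} (h : ∀ b, ¬ P b) : pick P = none :=
  dif_neg (by simpa using h)

theorem pick_getD {β : Type*} {P : β → Prop} (h : ∃ b, P b) (d : β) : P ((pick P).getD d) := by
  rw [pick, dif_pos h]
  exact h.choose_spec

/-- A perfectly balanced assignment of whole pieces that is closest to `init`. -/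
noncomputable def closest (init : Assignment n ℓ) (L : Fin n → Fin n) : Assignment n ℓ :=
  (pick fun f => (Consistent L f ∧ PerfectlyBalanced f) ∧
    ∀ g, Consistent L g ∧ PerfectlyBalanced g → numMoved init f ≤ numMoved init g).getD init

theorem exists_closest (init : Assignment n ℓ) {P : Assignment n ℓ → Prop} (h : ∃ g, P g) :
    ∃ f, P f ∧ ∀ g, P g → numMoved init f ≤ numMoved init g := by
  obtain ⟨f, hf, hmin⟩ := Set.exists_min_image {f | P f} (numMoved init) (Set.toFinite _) h
  exact ⟨f, hf, hmin⟩

/-- The competitor `g` may depend on components not yet revealed; only its consistency with the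
current pieces matters. Thus the root, knowing the pieces alone, stays within the distance of `f`.
-/
theorem closest_spec (init : Assignment n ℓ) {L : Fin n → Fin n} {g : Assignment n ℓ}
    (hg : Consistent L g) (hb : PerfectlyBalanced g) :
    Consistent L (closest init L) ∧ PerfectlyBalanced (closest init L) ∧
      numMoved init (closest init L) ≤ numMoved init g := by
  have h := pick_getD (exists_closest init
    (P := fun f => Consistent L f ∧ PerfectlyBalanced f) ⟨g, hg, hb⟩) init
  exact ⟨h.1.1, h.1.2, h.2 g ⟨hg, hb⟩⟩

/-- A perfectly balanced assignment of whole pieces that rearranges at least half of the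
vertices. -/
noncomputable def reset (loc : Assignment n ℓ) (L : Fin n → Fin n) : Assignment n ℓ :=
  (pick fun f => Consistent L f ∧ PerfectlyBalanced f ∧ n ≤ 2 * numMoved loc f).getD loc

theorem PerfectlyBalanced.comp_perm {f : Assignment n ℓ} (hf : PerfectlyBalanced f)
    (σ : Equiv.Perm (Fin ℓ)) : PerfectlyBalanced (fun v => σ (f v)) := by
  intro j
  refine Eq.trans ?_ (hf (σ.symm j))
  simp only [load, ← Equiv.eq_symm_apply]

/-- Rotating the server names in `g` gives a second arrangement that disagrees with `g` at every
vertex when there are at least two servers. Each vertex moves for at least one of the two, so one of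
them moves half of all vertices. -/
theorem reset_spec (hℓ : 2 ≤ ℓ) (loc : Assignment n ℓ) {L : Fin n → Fin n} {g : Assignment n ℓ}
    (hg : Consistent L g) (hb : PerfectlyBalanced g) :
    Consistent L (reset loc L) ∧ PerfectlyBalanced (reset loc L) ∧
      n ≤ 2 * numMoved loc (reset loc L) := by
  refine pick_getD (P := fun f => Consistent L f ∧ PerfectlyBalanced f ∧ n ≤ 2 * numMoved loc f)
    ?_ loc
  obtain ⟨m, rfl⟩ : ∃ m, ℓ = m + 2 := ⟨ℓ - 2, by omega⟩
  set g' : Assignment n (m + 2) := fun v => finRotate (m + 2) (g v) with hg'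
  have hsum : n ≤ numMoved loc g + numMoved loc g' := by
    rw [numMoved_eq_sum, numMoved_eq_sum, ← Finset.sum_add_distrib]
    calc n = ∑ v : Fin n, 1 := by simp
      _ ≤ _ := Finset.sum_le_sum fun v _ => by
        have : g v ≠ g' v := by simp [hg']
        by_cases h : loc v = g v
        · simp [h, this]
        · simp [h]
  by_cases h : n ≤ 2 * numMoved loc g
  · exact ⟨g, hg, hb, h⟩
  · exact ⟨g', fun x y hxy => by simp only [hg', hg x y hxy], hb.comp_perm _, by omega⟩

end Choices

/-! ### Ground truth components -/

section GroundTruth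

variable {n ℓ : ℕ}

/-- A perfectly balanced assignment that keeps every ground truth component on one server. -/
structure Instance.Good (I : Instance n ℓ) (f : Assignment n ℓ) : Prop where
  reach : ∀ x y, I.graph.Reachable x y → f x = f y
  balanced : PerfectlyBalanced f

theorem Instance.card_component (I : Instance n ℓ) (c : I.graph.ConnectedComponent)
    [DecidablePred fun v => I.graph.connectedComponentMk v = c] :
    (Finset.univ.filter fun v => I.graph.connectedComponentMk v = c).card * ℓ = n := by
  refine Eq.trans ?_ (I.component_card c)
  rw [← Set.ncard_coe_finset]
  congr 2
  ext v
  simp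

open Classical in
-- Double counting: components of size n/ℓ partition n vertices.
theorem Instance.card_connectedComponent (I : Instance n ℓ) (hn : 0 < n) :
    Fintype.card I.graph.ConnectedComponent = ℓ := by
  have h : ∑ c : I.graph.ConnectedComponent,
      (Finset.univ.filter fun v => I.graph.connectedComponentMk v = c).card = n := by
    rw [← Finset.card_eq_sum_card_fiberwise (s := Finset.univ)
      (f := I.graph.connectedComponentMk) (fun _ _ => Finset.mem_coe.2 (Finset.mem_univ _))]
    simp
  have h2 : ∑ c : I.graph.ConnectedComponent,
      (Finset.univ.filter fun v => I.graph.connectedComponentMk v = c).card * ℓ = n * ℓ := by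
    rw [← Finset.sum_mul, h]
  rw [Finset.sum_congr rfl fun c _ => I.card_component c] at h2
  simp only [Finset.sum_const, Finset.card_univ, smul_eq_mul] at h2
  rw [mul_comm] at h2
  exact Nat.eq_of_mul_eq_mul_left hn h2

theorem Instance.exists_good (I : Instance n ℓ) (hn : 0 < n) : ∃ f, I.Good f := by
  classical
  let e : I.graph.ConnectedComponent ≃ Fin ℓ :=
    Fintype.equivFinOfCardEq (I.card_connectedComponent hn)
  refine ⟨fun v => e (I.graph.connectedComponentMk v), fun x y h => ?_, fun j => ?_⟩
  · rw [SimpleGraph.ConnectedComponent.eq.2 h]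
  · refine Eq.trans ?_ (I.card_component (e.symm j))
    simp only [load, Equiv.eq_symm_apply]

theorem Instance.IsPerfectPartitioning.good {I : Instance n ℓ} {a : Assignment n ℓ}
    (h : I.IsPerfectPartitioning a) : I.Good a := by
  have key : ∀ j, ∃ c : I.graph.ConnectedComponent, c.supp = {v | a v = j} := fun j => by
    have : {v | a v = j} ∈ Set.range fun c : I.graph.ConnectedComponent => c.supp :=
      h ▸ Set.mem_range_self j
    exact this
  constructor
  · intro x y hxy
    obtain ⟨c, hc⟩ := key (a y)
    have hy : y ∈ c.supp := by rw [hc]; rfl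
    have hx : x ∈ c.supp := by
      rw [SimpleGraph.ConnectedComponent.mem_supp_iff] at hy ⊢
      rw [← hy]
      exact SimpleGraph.ConnectedComponent.eq.2 hxy
    rw [hc] at hx
    exact hx
  · intro j
    obtain ⟨c, hc⟩ := key j
    refine Eq.trans ?_ (I.component_card c)
    rw [hc, load, ← Set.ncard_coe_finset]
    simp

/-- Two components on one server would need 2n/ℓ places, more than the capacity. So components go to
servers injectively, and there are equally many of both. -/
theorem Instance.perfect_of_valid (I : Instance n ℓ) (hn : 0 < n) {ε : ℝ}
    (hε2 : ε < 1 / 2) {a : Assignment n ℓ} (hv : Valid ε a)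
    (hr : ∀ x y, I.graph.Reachable x y → a x = a y) : I.IsPerfectPartitioning a := by
  classical
  have hℓ : 0 < ℓ := Fin.pos (a ⟨0, hn⟩)
  let F : I.graph.ConnectedComponent → Fin ℓ :=
    SimpleGraph.ConnectedComponent.lift a (fun x y p _ => hr x y ⟨p⟩)
  have hF : ∀ v, F (I.graph.connectedComponentMk v) = a v := fun v => rfl
  have hinj : Function.Injective F := by
    intro c d hcd
    by_contra hne
    have hsub : (Finset.univ.filter fun v => I.graph.connectedComponentMk v = c) ∪
        (Finset.univ.filter fun v => I.graph.connectedComponentMk v = d) ⊆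
        Finset.univ.filter fun v => a v = F c := by
      intro v hv
      simp only [Finset.mem_union, Finset.mem_filter, Finset.mem_univ, true_and] at hv ⊢
      rw [← hF]
      rcases hv with h | h <;> rw [h]
      exact hcd.symm
    have hdis : Disjoint (Finset.univ.filter fun v => I.graph.connectedComponentMk v = c)
        (Finset.univ.filter fun v => I.graph.connectedComponentMk v = d) := by
      rw [Finset.disjoint_filter]
      rintro v _ rfl h
      exact hne h
    have hcard := Finset.card_le_card hsub
    rw [Finset.card_union_of_disjoint hdis] at hcard
    -- Multiplying by `ℓ` avoids the division in the component size n/ℓ.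
    have h1 : 2 * n ≤ load a (F c) * ℓ := by
      have := Nat.mul_le_mul_right ℓ hcard
      rw [add_mul, I.card_component, I.card_component] at this
      unfold load
      omega
    have h2 := hv (F c)
    have hℓ' : (0 : ℝ) < ℓ := by exact_mod_cast hℓ
    have hn' : (0 : ℝ) < n := by exact_mod_cast hn
    rw [le_div_iff₀ hℓ'] at h2
    have h3 : (2 : ℝ) * n ≤ load a (F c) * ℓ := by exact_mod_cast h1
    nlinarith
  have hbij : Function.Bijective F :=
    (Fintype.bijective_iff_injective_and_card F).2
      ⟨hinj, by rw [I.card_connectedComponent hn, Fintype.card_fin]⟩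
  have hset : ∀ c, {v | a v = F c} = c.supp := by
    intro c
    ext v
    rw [SimpleGraph.ConnectedComponent.mem_supp_iff, Set.mem_ofPred_eq, ← hF]
    exact ⟨fun h => hinj h, fun h => by rw [h]⟩
  unfold Instance.IsPerfectPartitioning
  ext S
  constructor
  · rintro ⟨j, rfl⟩
    obtain ⟨c, rfl⟩ := hbij.2 j
    exact ⟨c, (hset c).symm⟩
  · rintro ⟨c, rfl⟩
    exact ⟨F c, hset c⟩

theorem OfflineSchedule.numMoved_le_moves {I : Instance n ℓ} {ε : ℝ} (O : OfflineSchedule I ε) :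
    numMoved I.init (O.pos I.requests.length) ≤ O.moves := by
  unfold moves
  generalize I.requests.length = r
  induction r with
  | zero => simp
  | succ r ih =>
    rw [Finset.sum_range_succ, ← add_assoc]
    exact (numMoved_triangle _ _ _).trans (Nat.add_le_add_right ih _)

/-- The pieces described by the labels lie inside ground truth components and join the endpoints
of all requests in `σ`. -/
structure Instance.Tracks (I : Instance n ℓ) (L : Fin n → Fin n) (σ : List (Fin n × Fin n)) :
    Prop where
  sound : ∀ x y, L x = L y → I.graph.Reachable x y
  joined : ∀ e ∈ σ, L e.1 = L e.2

theorem Instance.Tracks.consistent {I : Instance n ℓ} {L : Fin n → Fin n}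
    {σ : List (Fin n × Fin n)} (h : I.Tracks L σ) {f : Assignment n ℓ} (hf : I.Good f) :
    Consistent L f := fun x y hxy => hf.reach x y (h.sound x y hxy)

theorem Instance.Tracks.same {I : Instance n ℓ} {L : Fin n → Fin n}
    {σ : List (Fin n × Fin n)} (h : I.Tracks L σ) {e : Fin n × Fin n} (he : L e.1 = L e.2) :
    I.Tracks L (σ ++ [e]) :=
  ⟨h.sound, fun e' he' => by
    rcases List.mem_append.1 he' with h' | h'
    · exact h.joined e' h'
    · rw [List.mem_singleton.1 h', he]⟩

theorem Instance.Tracks.relabel {I : Instance n ℓ} {L : Fin n → Fin n}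
    {σ : List (Fin n × Fin n)} (h : I.Tracks L σ) {e : Fin n × Fin n} (he : e ∈ I.requests)
    {a b : Fin n} (hab : a = e.1 ∧ b = e.2 ∨ a = e.2 ∧ b = e.1) :
    I.Tracks (relabel L a b) (σ ++ [e]) := by
  have hr : I.graph.Reachable a b := by
    have := (I.requests_adj e he).reachable
    rcases hab with ⟨rfl, rfl⟩ | ⟨rfl, rfl⟩
    · exact this
    · exact this.symm
  constructor
  · intro x y hxy
    unfold OnlinePartition.relabel at hxy
    split_ifs at hxy with h1 h2 h2
    · exact (h.sound x a h1).trans (h.sound y a h2).symm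
    · exact ((h.sound x a h1).trans hr).trans (h.sound b y hxy)
    · exact (h.sound x b hxy).trans (hr.symm.trans (h.sound y a h2).symm)
    · exact h.sound x y hxy
  · intro e' he'
    rcases List.mem_append.1 he' with h' | h'
    · simp only [OnlinePartition.relabel, h.joined e' h']
    · rw [List.mem_singleton.1 h']
      unfold OnlinePartition.relabel
      rcases hab with ⟨rfl, rfl⟩ | ⟨rfl, rfl⟩ <;> simp

/-- Once all requests are processed, labels are constant along every walk of the revealed graph, so
pieces and components coincide. -/
theorem Instance.Tracks.reachable {I : Instance n ℓ} {L : Fin n → Fin n}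
    (h : I.Tracks L I.requests) {x y : Fin n} (hxy : I.graph.Reachable x y) : L x = L y := by
  obtain ⟨p⟩ := (I.reveals x y).2 hxy
  induction p with
  | nil => rfl
  | cons hadj p ih =>
    refine Eq.trans ?_ (ih ((I.reveals _ _).1 ⟨p⟩))
    rw [revealedGraph, SimpleGraph.fromRel_adj] at hadj
    rcases hadj.2 with h' | h'
    · exact h.joined _ h'
    · exact (h.joined _ h').symm

theorem Instance.tracks_id (I : Instance n ℓ) : I.Tracks id [] :=
  ⟨fun x y h => by rw [show x = y from h], by simp⟩

/-- The label of `a` disappears. The number of labels is the budget for messages about merges that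
move nothing. -/
theorem card_image_relabel {L : Fin n → Fin n} {a b : Fin n} (hab : L a ≠ L b) :
    (Finset.univ.image (relabel L a b)).card + 1 ≤ (Finset.univ.image L).card := by
  rw [← Finset.card_erase_add_one (s := Finset.univ.image L) (a := L a)
    (Finset.mem_image_of_mem _ (Finset.mem_univ a))]
  gcongr
  intro l hl
  obtain ⟨w, -, rfl⟩ := Finset.mem_image.1 hl
  unfold relabel
  split_ifs with h
  · exact Finset.mem_erase.2 ⟨hab.symm, Finset.mem_image_of_mem _ (Finset.mem_univ b)⟩
  · exact Finset.mem_erase.2 ⟨h, Finset.mem_image_of_mem _ (Finset.mem_univ w)⟩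

end GroundTruth

/-! ### The distributed algorithm -/

section Algorithm

/-- The contents of the messages of the algorithm. -/
inductive Note (n ℓ : ℕ) : Type
  /-- For the request `(u, v)`: the label and the size of the sender's piece, the number of its
  vertices that are at home on the sender and on the receiver, and the load of the sender. -/
  | stat (u v l : Fin n) (size own other load : Fin (n + 1))
  /-- The request `(u, v)` leads to an overload: report to the root. -/
  | alarm (u v : Fin n)
  /-- The report, after the request `(u, v)`, that the sender hosts `w`, with its home server and
  label. -/
  | info (u v w : Fin n) (h : Fin ℓ) (l : Fin n)
  /-- The pieces of `u` and `v` are to be merged. -/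
  | fwd (u v : Fin n)
  /-- The receiver has to send `w` to server `d`, with the label `l`. -/
  | cmd (w : Fin n) (d : Fin ℓ) (l : Fin n)
  /-- The vertex `w` itself, with its home server and label. -/
  | carry (w : Fin n) (h : Fin ℓ) (l : Fin n)

variable {n ℓ : ℕ}

/-- The vertex that is moved by a message. -/
def Note.vertex : Note n ℓ → Option (Fin n)
  | .carry w _ _ => some w
  | _ => none

/-- The messages to which a server reacts by itself, whatever else it receives. -/
def Note.Trigger : Note n ℓ → Prop
  | .stat .. => True
  | .alarm .. => True
  | .fwd .. => True
  | _ => False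

/-- Bounding n + 1 by n² and ℓ by n, each of the six kinds of notes has at most n¹¹ values, the
maximum coming from `stat`. Six copies fit since 6 ≤ 2³ ≤ n³, hence the exponent 14. -/
theorem exists_encoding (hn : 2 ≤ n) (hℓ : ℓ ≤ n) :
    ∃ enc : Note n ℓ → Fin (n ^ 14), Function.Injective enc := by
  let F := Fin n
  let G := Fin (n + 1)
  let f : Note n ℓ → (F × F × F × G × G × G × G) ⊕ (F × F) ⊕ (F × F × F × Fin ℓ × F) ⊕ (F × F) ⊕
      (F × Fin ℓ × F) ⊕ (F × Fin ℓ × F) := fun x =>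
    match x with
    | .stat u v l a b c d => .inl (u, v, l, a, b, c, d)
    | .alarm u v => .inr (.inl (u, v))
    | .info u v w h l => .inr (.inr (.inl (u, v, w, h, l)))
    | .fwd u v => .inr (.inr (.inr (.inl (u, v))))
    | .cmd w d l => .inr (.inr (.inr (.inr (.inl (w, d, l)))))
    | .carry w h l => .inr (.inr (.inr (.inr (.inr (w, h, l)))))
  have hf : Function.Injective f := by
    intro x y hxy
    cases x <;> cases y <;> simp_all [f]
  obtain ⟨g⟩ : Nonempty (((F × F × F × G × G × G × G) ⊕ (F × F) ⊕ (F × F × F × Fin ℓ × F) ⊕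
      (F × F) ⊕ (F × Fin ℓ × F) ⊕ (F × Fin ℓ × F)) ↪ Fin (n ^ 14)) := by
    apply Function.Embedding.nonempty_of_card_le
    simp only [F, G, Fintype.card_sum, Fintype.card_prod, Fintype.card_fin]
    have h1 : n + 1 ≤ n ^ 2 := by nlinarith
    have hp : ∀ k, k ≤ 11 → n ^ k ≤ n ^ 11 := fun k hk => Nat.pow_le_pow_right (by omega) hk
    have a1 : n * (n * (n * ((n + 1) * ((n + 1) * ((n + 1) * (n + 1)))))) ≤ n ^ 11 := by
      calc _ ≤ n * (n * (n * (n ^ 2 * (n ^ 2 * (n ^ 2 * n ^ 2))))) := by gcongr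
        _ = n ^ 11 := by ring
    have a2 : n * n ≤ n ^ 11 := by simpa [sq] using hp 2 (by norm_num)
    have a3 : n * (n * (n * (ℓ * n))) ≤ n ^ 11 := by
      calc _ ≤ n * (n * (n * (n * n))) := by gcongr
        _ = n ^ 5 := by ring
        _ ≤ _ := hp 5 (by norm_num)
    have a4 : n * (ℓ * n) ≤ n ^ 11 := by
      calc _ ≤ n * (n * n) := by gcongr
        _ = n ^ 3 := by ring
        _ ≤ _ := hp 3 (by norm_num)
    have a5 : 8 * n ^ 11 ≤ n ^ 14 := by
      calc 8 * n ^ 11 = 2 ^ 3 * n ^ 11 := by norm_num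
        _ ≤ n ^ 3 * n ^ 11 := by gcongr
        _ = n ^ 14 := by ring
    omega
  exact ⟨g ∘ f, g.injective.comp hf⟩

/-- What a server knows about the vertices: home server and label of its own ones. -/
abbrev Know (n ℓ : ℕ) := Fin n → Option (Fin ℓ × Fin n)

/-- The overview of the root: location, home server and label of all vertices. -/
structure Overview (n ℓ : ℕ) where
  loc : Assignment n ℓ
  init : Assignment n ℓ
  lab : Fin n → Fin n

/-- The local state of a server. -/
structure LocalState (n ℓ : ℕ) where
  central : Bool
  know : Know n ℓ
  view : Option (Overview n ℓ)

/-- The label of an own vertex. -/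
def Know.label (κ : Know n ℓ) (x : Fin n) : Fin n :=
  match κ x with
  | some p => p.2
  | none => x

open Classical in
/-- The size of an own piece. -/
noncomputable def Know.size (κ : Know n ℓ) (l : Fin n) : ℕ :=
  (Finset.univ.filter fun w => ∃ h, κ w = some (h, l)).card

/-- The number of vertices of an own piece that are at home on server `h`. -/
def Know.home (κ : Know n ℓ) (l : Fin n) (h : Fin ℓ) : ℕ :=
  (Finset.univ.filter fun w => κ w = some (h, l)).card

/-- The load of the server. -/
def Know.load (κ : Know n ℓ) : ℕ :=
  (Finset.univ.filter fun w => (κ w).isSome).card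

/-- The messages prescribed by `g` for the single vertices. -/
def sendAll {β : Type*} (g : Fin n → Option β) : List β := (List.finRange n).filterMap g

/-- The answer to an overload: either the piece of `u` moves, or that of `v`, or none fits. Here `p`
and `q` are the sizes of the pieces, `xu` and `xv` the numbers of their vertices that are at home on
the two hosts, and `lu` and `lv` the loads of the hosts. -/
def verdict (cap p q xu xv lu lv : ℕ) : Option Bool :=
  if 7 * (p + q) < 8 * xv ∨ 8 * xu ≤ 7 * (p + q) ∧ p ≤ q then
    if lv + p ≤ cap then some true else none
  else
    if lu + q ≤ cap then some false else none

/-- The plan of the root for two pieces on different servers. -/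
noncomputable def replan (cap : ℕ) (o : Overview n ℓ) (a b : Fin n) : Overview n ℓ where
  loc := if load o.loc (o.loc b) + classSize o.lab a ≤ cap then shift o.loc o.lab a b
    else closest o.init (relabel o.lab a b)
  init := o.init
  lab := relabel o.lab a b

/-- The new arrangement when the pieces of `u` and `v` are merged in the centralized phase. -/
noncomputable def centralPlan (cap : ℕ) (o : Overview n ℓ) (u v : Fin n) : Overview n ℓ :=
  if classSize o.lab u ≤ classSize o.lab v then replan cap o u v else replan cap o v u

/-- Reaction to a request that involves server `j`. -/
noncomputable def onRequest (root j : Fin ℓ) (st : LocalState n ℓ) (u v : Fin n) (hu hv : Fin ℓ) :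
    LocalState n ℓ × List (Fin ℓ × Note n ℓ) :=
  let stat (x : Fin n) (i : Fin ℓ) : Note n ℓ :=
    .stat u v (st.know.label x) (Fin.ofNat _ (st.know.size (st.know.label x)))
      (Fin.ofNat _ (st.know.home (st.know.label x) j))
      (Fin.ofNat _ (st.know.home (st.know.label x) i)) (Fin.ofNat _ st.know.load)
  if hu = hv then
    if st.know.label u = st.know.label v then (st, [])
    else ({ st with know := fun w => (st.know w).map fun p =>
              (p.1, if p.2 = st.know.label u then st.know.label v else p.2) },
      if st.central then [(root, .fwd u v)] else [])
  else if st.central then (st, if j = hu then [(root, .fwd u v)] else [])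
  else (st, if j = hu then [(hv, stat u hv)] else [(hu, stat v hu)])

/-- Send the piece labelled `l` to server `d`, where it gets the label `l'`. -/
def sendPiece (st : LocalState n ℓ) (l : Fin n) (d : Fin ℓ) (l' : Fin n) :
    LocalState n ℓ × List (Fin ℓ × Note n ℓ) :=
  ({ st with know := fun w => (st.know w).filter fun p => p.2 ≠ l },
    sendAll fun w => ((st.know w).filter fun p => p.2 = l).map fun p => (d, .carry w p.1 l'))

/-- Reaction of server `j` to the message about a request from the other host `i`. -/
noncomputable def onStat (cap : ℕ) (j : Fin ℓ) (st : LocalState n ℓ) (i : Fin ℓ)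
    (u v l : Fin n) (size own other load : ℕ) : LocalState n ℓ × List (Fin ℓ × Note n ℓ) :=
  if (st.know u).isSome then
    match verdict cap (st.know.size (st.know.label u)) size
        (st.know.home (st.know.label u) j + other) (st.know.home (st.know.label u) i + own)
        st.know.load load with
    | some true => sendPiece st (st.know.label u) i l
    | some false => (st, [])
    | none => (st, (List.finRange ℓ).map fun d => (d, .alarm u v))
  else
    match verdict cap size (st.know.size (st.know.label v))
        (own + st.know.home (st.know.label v) i) (other + st.know.home (st.know.label v) j)
        load st.know.load with
    | some false => sendPiece st (st.know.label v) i l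
    | _ => (st, [])

/-- Reaction to an overload: report to the root. -/
def onAlarm (root : Fin ℓ) (st : LocalState n ℓ) (u v : Fin n) :
    LocalState n ℓ × List (Fin ℓ × Note n ℓ) :=
  ({ st with central := true },
    sendAll fun w => (st.know w).map fun p => (root, .info u v w p.1 p.2))

/-- The overview that results from the reports. -/
noncomputable def overviewOf (j : Fin ℓ) (u v : Fin n) (R : Set (Fin ℓ × Note n ℓ)) :
    Overview n ℓ :=
  let r (w : Fin n) : Fin ℓ × Fin ℓ × Fin n :=
    (pick fun p : Fin ℓ × Fin ℓ × Fin n => (p.1, Note.info u v w p.2.1 p.2.2) ∈ R).getD (j, j, w)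
  ⟨fun w => (r w).1, fun w => (r w).2.1, fun w => (r w).2.2⟩

/-- Reaction of the root to the reports: it merges the pieces of `u` and `v` and rearranges. -/
noncomputable def onInfo (j : Fin ℓ) (st : LocalState n ℓ) (u v : Fin n)
    (R : Set (Fin ℓ × Note n ℓ)) : LocalState n ℓ × List (Fin ℓ × Note n ℓ) :=
  let o := overviewOf j u v R
  let L := relabel o.lab u v
  let loc := reset o.loc L
  ({ st with view := some ⟨loc, o.init, L⟩ },
    sendAll fun w => some (o.loc w, .cmd w (loc w) (L w)))

/-- Reaction of the root to a merge. -/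
noncomputable def onFwd (cap : ℕ) (st : LocalState n ℓ) (u v : Fin n) :
    LocalState n ℓ × List (Fin ℓ × Note n ℓ) :=
  match st.view with
  | none => (st, [])
  | some o =>
    if o.loc u = o.loc v then ({ st with view := some ⟨o.loc, o.init, relabel o.lab u v⟩ }, [])
    else
      let o' := centralPlan cap o u v
      ({ st with view := some o' }, sendAll fun w =>
        if o'.loc w = o.loc w ∧ o'.lab w = o.lab w then none
        else some (o.loc w, .cmd w (o'.loc w) (o'.lab w)))

/-- Reaction to commands and to arriving vertices. -/
noncomputable def deliver (j : Fin ℓ) (st : LocalState n ℓ) (R : Set (Fin ℓ × Note n ℓ)) :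
    LocalState n ℓ × List (Fin ℓ × Note n ℓ) :=
  let order (w : Fin n) := pick fun p : Fin ℓ × Fin n => ∃ i, (i, Note.cmd w p.1 p.2) ∈ R
  let arrival (w : Fin n) := pick fun p : Fin ℓ × Fin n => ∃ i, (i, Note.carry w p.1 p.2) ∈ R
  ({ st with know := fun w =>
      match arrival w with
      | some p => some p
      | none =>
        match order w with
        | some p => if p.1 = j then (st.know w).map fun q => (q.1, p.2) else none
        | none => st.know w },
    sendAll fun w =>
      match order w with
      | some p => if p.1 = j then none else (st.know w).map fun q => (p.1, .carry w q.1 p.2)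
      | none => none)

/-- The local computation of server `j`, which receives the messages in `R`. -/
noncomputable def handle (root : Fin ℓ) (cap : ℕ) (j : Fin ℓ) (st : LocalState n ℓ)
    (nt : Option (Notice n ℓ)) (R : Set (Fin ℓ × Note n ℓ)) :
    LocalState n ℓ × List (Fin ℓ × Note n ℓ) :=
  match nt with
  | some e => onRequest root j st e.edge.1 e.edge.2 e.hosts.1 e.hosts.2
  | none =>
    match pick fun p : Fin ℓ × Note n ℓ => p ∈ R ∧ p.2.Trigger with
    | some (i, .stat u v l a b c d) => onStat cap j st i u v l a b c d
    | some (_, .alarm u v) => onAlarm root st u v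
    | some (_, .fwd u v) => onFwd cap st u v
    | _ =>
      match pick fun q : Fin n × Fin n => ∃ i w h l, (i, Note.info q.1 q.2 w h l) ∈ R with
      | some q => onInfo j st q.1 q.2 R
      | none => deliver j st R

variable {B : ℕ}

/-- The message with destination and content `p`. -/
def toMessage (enc : Note n ℓ → Fin (n ^ B)) (p : Fin ℓ × Note n ℓ) : Message n ℓ B :=
  ⟨p.1, p.2.vertex, enc p.2⟩

/-- The distributed algorithm. -/
noncomputable def algorithm (root : Fin ℓ) (cap : ℕ) (enc : Note n ℓ → Fin (n ^ B)) :
    DistributedAlgorithm n ℓ B where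
  State := LocalState n ℓ
  start j S := ⟨false, fun w => if w ∈ S then some (j, w) else none, none⟩
  step j _ st nt inbox :=
    let r := handle root cap j st nt {p | ∃ m, (p.1, m) ∈ inbox ∧ m.payload = enc p.2}
    (r.1, r.2.map (toMessage enc))

end Algorithm

/-! ### Rounds -/

section Rounds

variable {n ℓ B : ℕ} {root : Fin ℓ} {cap : ℕ} {enc : Note n ℓ → Fin (n ^ B)}

/-- A description of a configuration: local states, messages in transit, assignment, pending
requests, and the numbers of messages, moves and paid requests. -/
structure Shape (c : (algorithm root cap enc).Config) (S : Fin ℓ → LocalState n ℓ)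
    (out : Fin ℓ → List (Fin ℓ × Note n ℓ)) (loc : Assignment n ℓ)
    (pend : List (Fin n × Fin n)) (m mv cm : ℕ) : Prop where
  state : ∀ j, c.state j = S j
  outbox : ∀ j, c.outbox j = (out j).map (toMessage enc)
  loc : c.loc = loc
  pending : c.pending = pend
  messages : c.messages = m
  moves : c.moves = mv
  comm : c.comm = cm

/-- What server `j` receives, with the senders. -/
def received (out : Fin ℓ → List (Fin ℓ × Note n ℓ)) (j : Fin ℓ) : Set (Fin ℓ × Note n ℓ) :=
  {p | (j, p.2) ∈ out p.1}

/-- `loc'` results from `loc` by the moves in `out`. -/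
def Relocates (out : Fin ℓ → List (Fin ℓ × Note n ℓ)) (loc loc' : Assignment n ℓ) : Prop :=
  ∀ v, (∀ p ∈ out (loc v), p.2.vertex = some v → p.1 = loc' v) ∧
    ((∀ p ∈ out (loc v), p.2.vertex ≠ some v) → loc' v = loc v)

/-- Injectivity of `enc` makes payloads decodable. The set forgets order and multiplicity, which the
reactions of the servers do not use. -/
theorem Shape.inbox (henc : Function.Injective enc) {c : (algorithm root cap enc).Config}
    {S out loc pend m mv cm} (h : Shape c S out loc pend m mv cm) (j : Fin ℓ) :
    {p : Fin ℓ × Note n ℓ | ∃ m, (p.1, m) ∈ c.inbox j ∧ m.payload = enc p.2} =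
      received out j := by
  ext ⟨i, x⟩
  simp only [DistributedAlgorithm.Config.inbox, received, Set.mem_ofPred_eq, List.mem_flatMap,
    List.mem_finRange, true_and, List.mem_map, List.mem_filter, h.outbox, decide_eq_true_eq]
  constructor
  · rintro ⟨m, ⟨i', m', ⟨⟨p, hp, rfl⟩, hd⟩, he⟩, hx⟩
    obtain ⟨rfl, rfl⟩ := Prod.mk.inj he
    obtain ⟨d, y⟩ := p
    have hy : y = x := henc hx
    have hd' : d = j := hd
    rw [← hy, ← hd']
    exact hp
  · intro hp
    exact ⟨_, ⟨i, _, ⟨⟨(j, x), hp, rfl⟩, rfl⟩, rfl⟩, rfl⟩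

theorem Shape.localStep (henc : Function.Injective enc) {c : (algorithm root cap enc).Config}
    {S out loc pend m mv cm} (h : Shape c S out loc pend m mv cm)
    (req : Option (Fin n × Fin n)) (j : Fin ℓ) :
    c.localStep req j = ((handle root cap j (S j) (c.notice req j) (received out j)).1,
      (handle root cap j (S j) (c.notice req j) (received out j)).2.map (toMessage enc)) := by
  rw [← h.inbox henc, ← h.state]
  rfl

/-- `Relocates` demands that all messages of the host carrying a vertex agree on the destination, so
it is irrelevant that the model follows the first one. -/
theorem Shape.round (henc : Function.Injective enc) {c : (algorithm root cap enc).Config}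
    {S out loc pend m mv cm} (h : Shape c S out loc pend m mv cm)
    (req : Option (Fin n × Fin n)) {S' : Fin ℓ → LocalState n ℓ}
    {out' : Fin ℓ → List (Fin ℓ × Note n ℓ)} {loc' : Assignment n ℓ}
    (hS : ∀ j, handle root cap j (S j) (c.notice req j) (received out j) = (S' j, out' j))
    (hloc : Relocates out' loc loc') :
    Shape (c.round req) S' out' loc' pend (m + ∑ j, (out' j).length) (mv + numMoved loc loc')
      (cm + req.elim 0 (commCost loc)) := by
  have hstep : ∀ j, c.localStep req j = (S' j, (out' j).map (toMessage enc)) := fun j => by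
    rw [h.localStep henc, hS]
  have hnew : c.newLoc req = loc' := by
    funext v
    unfold DistributedAlgorithm.Config.newLoc
    rw [hstep, h.loc]
    dsimp only
    rw [List.find?_map]
    cases hf : (out' (loc v)).find?
        ((fun m : Message n ℓ B => decide (m.vertex = some v)) ∘ toMessage enc) with
    | none =>
      rw [List.find?_eq_none] at hf
      simp only [Option.map_none]
      refine ((hloc v).2 fun p hp hpv => ?_).symm
      exact hf p hp (decide_eq_true hpv)
    | some p =>
      simp only [Option.map_some]
      have h1 := List.mem_of_find?_eq_some hf
      have h2 := List.find?_some hf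
      exact (hloc v).1 p h1 (of_decide_eq_true h2)
  refine ⟨fun j => ?_, fun j => ?_, ?_, ?_, ?_, ?_, ?_⟩
  · exact congrArg Prod.fst (hstep j)
  · exact congrArg Prod.snd (hstep j)
  · exact hnew
  · exact h.pending
  · simp only [DistributedAlgorithm.Config.round, hstep, List.length_map, h.messages]
  · simp only [DistributedAlgorithm.Config.round, hnew, h.loc, h.moves]
  · simp only [DistributedAlgorithm.Config.round, h.comm, h.loc]
    cases req <;> rfl

theorem relocates_self {out : Fin ℓ → List (Fin ℓ × Note n ℓ)} {loc : Assignment n ℓ}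
    (h : ∀ j, ∀ p ∈ out j, p.2.vertex = none) : Relocates out loc loc := by
  refine fun v => ⟨fun p hp hv => ?_, fun _ => rfl⟩
  rw [h _ p hp] at hv
  cases hv

theorem Shape.idle {c : (algorithm root cap enc).Config} {S loc pend m mv cm}
    (h : Shape c S (fun _ => []) loc pend m mv cm) : c.Idle := fun j => by simp [h.outbox]

/-- A round in which messages are in transit. -/
theorem Shape.next (henc : Function.Injective enc) {c : (algorithm root cap enc).Config}
    {S out loc pend m mv cm} (h : Shape c S out loc pend m mv cm) (hbusy : ∃ i, out i ≠ [])
    {S' : Fin ℓ → LocalState n ℓ} {out' : Fin ℓ → List (Fin ℓ × Note n ℓ)}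
    {loc' : Assignment n ℓ}
    (hS : ∀ j, handle root cap j (S j) none (received out j) = (S' j, out' j))
    (hloc : Relocates out' loc loc') :
    Shape c.next S' out' loc' pend (m + ∑ j, (out' j).length) (mv + numMoved loc loc') cm := by
  have hidle : ¬ c.Idle := by
    obtain ⟨i, hi⟩ := hbusy
    intro hc
    apply hi
    have := hc i
    rwa [h.outbox, List.map_eq_nil_iff] at this
  rw [DistributedAlgorithm.Config.next, if_neg hidle]
  exact h.round henc none hS hloc

/-- A round in which a request arrives. -/
theorem Shape.next_request (henc : Function.Injective enc)
    {c : (algorithm root cap enc).Config} {S loc u v pend m mv cm}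
    (h : Shape c S (fun _ => []) loc ((u, v) :: pend) m mv cm)
    {S' : Fin ℓ → LocalState n ℓ} {out' : Fin ℓ → List (Fin ℓ × Note n ℓ)}
    (hS : ∀ j, (if loc u = j ∨ loc v = j then onRequest root j (S j) u v (loc u) (loc v)
      else handle root cap j (S j) none ∅) = (S' j, out' j))
    (hout : ∀ j, ∀ p ∈ out' j, p.2.vertex = none) :
    Shape c.next S' out' loc pend (m + ∑ j, (out' j).length) mv
      (cm + if loc u = loc v then 0 else 1) := by
  rw [DistributedAlgorithm.Config.next, if_pos h.idle]
  have e := h.pending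
  split
  · rename_i h'
    rw [e] at h'
    cases h'
  · rename_i e' rest h'
    rw [e] at h'
    cases h'
    have h0 : Shape (c := ({ c with pending := pend } : (algorithm root cap enc).Config))
        S (fun _ => []) loc pend m mv cm :=
      ⟨h.state, h.outbox, h.loc, rfl, h.messages, h.moves, h.comm⟩
    have hr : ∀ j, received (fun _ : Fin ℓ => ([] : List (Fin ℓ × Note n ℓ))) j = ∅ := by
      intro j; ext p; simp [received]
    have := h0.round henc (some (u, v)) (S' := S') (out' := out') (loc' := loc) (fun j => by
      rw [hr, ← hS j]
      simp only [DistributedAlgorithm.Config.notice, h.loc]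
      split_ifs <;> rfl) (relocates_self hout)
    rw [numMoved_self] at this
    exact this

end Rounds

section Protocol

variable {n ℓ B : ℕ} {root : Fin ℓ} {cap : ℕ} {enc : Note n ℓ → Fin (n ^ B)}

theorem mem_sendAll {β : Type*} {g : Fin n → Option β} {x : β} :
    x ∈ sendAll g ↔ ∃ w, g w = some x := by
  simp [sendAll, List.mem_filterMap]

theorem length_sendAll {β : Type*} (g : Fin n → Option β) :
    (sendAll g).length = (Finset.univ.filter fun w => (g w).isSome).card := by
  rw [sendAll, List.length_filterMap_eq_countP, List.countP_eq_length_filter,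
    ← List.toFinset_card_of_nodup ((List.nodup_finRange n).filter _)]
  congr 1
  ext w
  simp

theorem sendAll_none {β : Type*} : sendAll (fun _ : Fin n => (none : Option β)) = [] := by
  simp [sendAll]

/-! ### What a server computes -/

theorem deliver_empty (j : Fin ℓ) (st : LocalState n ℓ) : deliver j st ∅ = (st, []) := by
  have h1 : ∀ w : Fin n, (pick fun p : Fin ℓ × Fin n =>
      ∃ i, (i, Note.cmd w p.1 p.2) ∈ (∅ : Set (Fin ℓ × Note n ℓ))) = none :=
    fun w => pick_eq_none (by simp)
  have h2 : ∀ w : Fin n, (pick fun p : Fin ℓ × Fin n =>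
      ∃ i, (i, Note.carry w p.1 p.2) ∈ (∅ : Set (Fin ℓ × Note n ℓ))) = none :=
    fun w => pick_eq_none (by simp)
  unfold deliver
  simp only [h1, h2, sendAll_none]

theorem handle_deliver {j : Fin ℓ} {st : LocalState n ℓ} {R : Set (Fin ℓ × Note n ℓ)}
    (ht : ∀ p ∈ R, ¬ p.2.Trigger) (hi : ∀ i u v w h l, (i, Note.info u v w h l) ∉ R) :
    handle root cap j st none R = deliver j st R := by
  unfold handle
  rw [pick_eq_none (P := fun p => p ∈ R ∧ p.2.Trigger) fun p hp => ht p hp.1 hp.2,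
    pick_eq_none fun q hq => by obtain ⟨i, w, h, l, hq⟩ := hq; exact hi _ _ _ _ _ _ hq]

theorem handle_empty (j : Fin ℓ) (st : LocalState n ℓ) :
    handle root cap j st none ∅ = (st, []) := by
  rw [handle_deliver (by simp) (by simp), deliver_empty]

theorem handle_info {j : Fin ℓ} {st : LocalState n ℓ} {R : Set (Fin ℓ × Note n ℓ)} {u v : Fin n}
    (ht : ∀ p ∈ R, ∃ w h l, p.2 = Note.info u v w h l) (hne : R.Nonempty) :
    handle root cap j st none R = onInfo j st u v R := by
  unfold handle
  rw [pick_eq_none (P := fun p => p ∈ R ∧ p.2.Trigger) fun p hp => by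
    obtain ⟨w, h, l, e⟩ := ht p hp.1
    have := hp.2
    rw [e] at this
    exact this]
  obtain ⟨⟨i, x⟩, hx⟩ := hne
  obtain ⟨w, h, l, rfl⟩ := ht _ hx
  rw [pick_eq_some (b := (u, v)) ⟨i, w, h, l, hx⟩]
  rintro ⟨u', v'⟩ ⟨i', w', h', l', hx'⟩
  obtain ⟨_, _, _, e⟩ := ht _ hx'
  cases e
  rfl

theorem pick_trigger {i : Fin ℓ} {x : Note n ℓ} (hx : x.Trigger) :
    (pick fun p : Fin ℓ × Note n ℓ => p ∈ ({(i, x)} : Set (Fin ℓ × Note n ℓ)) ∧ p.2.Trigger) =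
      some (i, x) :=
  pick_eq_some ⟨rfl, hx⟩ fun _ h => h.1

/-! ### Canonical states -/

/-- What server `j` knows if all knowledge is up to date. -/
def knowOf (init loc : Assignment n ℓ) (L : Fin n → Fin n) (j : Fin ℓ) : Know n ℓ :=
  fun w => if loc w = j then some (init w, L w) else none

/-- The state of server `j` between two requests. -/
def canon (root : Fin ℓ) (init : Assignment n ℓ) (ph : Bool) (loc : Assignment n ℓ)
    (L : Fin n → Fin n) (j : Fin ℓ) : LocalState n ℓ :=
  ⟨ph, knowOf init loc L j, if ph = true ∧ j = root then some ⟨loc, init, L⟩ else none⟩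

/-- The state of server `j` when the vertices are on their way from `loc` to `loc'`. -/
def transit (root : Fin ℓ) (init : Assignment n ℓ) (ph : Bool) (loc loc' : Assignment n ℓ)
    (L' : Fin n → Fin n) (j : Fin ℓ) : LocalState n ℓ :=
  ⟨ph, fun w => if loc w = j ∧ loc' w = loc w then some (init w, L' w) else none,
    if ph = true ∧ j = root then some ⟨loc', init, L'⟩ else none⟩

/-- The vertices that server `i` sends. -/
def carryOut (init loc loc' : Assignment n ℓ) (L' : Fin n → Fin n) (i : Fin ℓ) :
    List (Fin ℓ × Note n ℓ) :=
  sendAll fun w => if loc w = i ∧ loc' w ≠ loc w then some (loc' w, .carry w (init w) (L' w))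
    else none

/-- The state of server `j` when the root has ordered a rearrangement. -/
def commanded (root : Fin ℓ) (init loc loc' : Assignment n ℓ) (L L' : Fin n → Fin n)
    (j : Fin ℓ) : LocalState n ℓ :=
  ⟨true, knowOf init loc L j, if j = root then some ⟨loc', init, L'⟩ else none⟩

/-- The orders of the root for all vertices except those in `keep`. -/
def orders (root : Fin ℓ) (loc loc' : Assignment n ℓ) (L' : Fin n → Fin n) (keep : Fin n → Prop)
    [DecidablePred keep] (i : Fin ℓ) : List (Fin ℓ × Note n ℓ) :=
  if i = root then sendAll fun w => if keep w then none else some (loc w, .cmd w (loc' w) (L' w))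
  else []

theorem knowOf_label (init : Assignment n ℓ) {loc : Assignment n ℓ} (L : Fin n → Fin n)
    {j : Fin ℓ} {x : Fin n} (hx : loc x = j) : (knowOf init loc L j).label x = L x := by
  simp [Know.label, knowOf, hx]

theorem knowOf_size (init : Assignment n ℓ) {loc : Assignment n ℓ} {L : Fin n → Fin n}
    (hc : Consistent L loc) {j : Fin ℓ} {x : Fin n} (hx : loc x = j) :
    (knowOf init loc L j).size (L x) = classSize L x := by
  rw [classSize_eq_card, Know.size]
  congr 1
  ext w
  simp only [Finset.mem_filter, Finset.mem_univ, true_and]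
  unfold knowOf
  constructor
  · rintro ⟨h, hw⟩
    split_ifs at hw
    simp only [Option.some.injEq, Prod.mk.injEq] at hw
    exact hw.2
  · intro hw
    exact ⟨init w, by rw [if_pos ((hc w x hw).trans hx), hw]⟩

theorem knowOf_home (init : Assignment n ℓ) {loc : Assignment n ℓ} {L : Fin n → Fin n}
    (hc : Consistent L loc) {j : Fin ℓ} {x : Fin n} (hx : loc x = j) (h : Fin ℓ) :
    (knowOf init loc L j).home (L x) h = homeCount init L x h := by
  rw [homeCount, classSum, Know.home, Finset.card_filter]
  refine Finset.sum_congr rfl fun w _ => ?_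
  unfold knowOf
  by_cases hw : L w = L x
  · simp [hc w x hw, hx, hw]
  · simp [hw]

theorem knowOf_load (init loc : Assignment n ℓ) (L : Fin n → Fin n) (j : Fin ℓ) :
    (knowOf init loc L j).load = load loc j := by
  rw [Know.load, load]
  congr 1
  ext w
  by_cases hw : loc w = j <;> simp [knowOf, hw]

theorem knowOf_isSome (init loc : Assignment n ℓ) (L : Fin n → Fin n) (j : Fin ℓ) (w : Fin n) :
    (knowOf init loc L j w).isSome = true ↔ loc w = j := by
  by_cases hw : loc w = j <;> simp [knowOf, hw]

theorem load_le (loc : Assignment n ℓ) (j : Fin ℓ) : load loc j ≤ n :=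
  (Finset.card_le_univ _).trans (by simp)

theorem val_ofNat {x : ℕ} (h : x ≤ n) : (Fin.ofNat (n + 1) x : ℕ) = x := by
  simp only [Fin.ofNat]
  exact Nat.mod_eq_of_lt (by omega)

theorem knowOf_relabel (init : Assignment n ℓ) (loc : Assignment n ℓ) (L : Fin n → Fin n)
    (u v : Fin n) (j : Fin ℓ) :
    (fun w => (knowOf init loc L j w).map fun p => (p.1, if p.2 = L u then L v else p.2)) =
      knowOf init loc (relabel L u v) j := by
  funext w
  unfold knowOf relabel
  by_cases hw : loc w = j <;> simp [hw]

/-- A server that does not host the class of `u` stores no label of it; hence merging on one server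
requires no announcement to the other hosts. -/
theorem knowOf_relabel_of_ne (init : Assignment n ℓ) {loc : Assignment n ℓ} {L : Fin n → Fin n}
    (hc : Consistent L loc) {u : Fin n} (v : Fin n) {j : Fin ℓ} (hj : loc u ≠ j) :
    knowOf init loc (relabel L u v) j = knowOf init loc L j := by
  funext w
  unfold knowOf relabel
  by_cases hw : loc w = j
  · have : L w ≠ L u := fun h => hj ((hc w u h).symm.trans hw)
    simp [hw, this]
  · simp [hw]

/-! ### Rearrangements -/

theorem sum_length_carryOut (init loc loc' : Assignment n ℓ) (L' : Fin n → Fin n) :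
    ∑ i, (carryOut init loc loc' L' i).length = numMoved loc loc' := by
  simp only [carryOut, length_sendAll]
  rw [numMoved, Finset.card_eq_sum_card_fiberwise (f := loc) (t := Finset.univ)
    (fun _ _ => Finset.mem_coe.2 (Finset.mem_univ _))]
  refine Finset.sum_congr rfl fun i _ => ?_
  congr 1
  ext w
  simp only [Finset.mem_filter, Finset.mem_univ, true_and]
  by_cases h : loc w = i ∧ loc' w ≠ loc w
  · rw [if_pos h]; simp [h.1]; rw [← h.1]; exact Ne.symm h.2
  · rw [if_neg h]; simp; tauto

theorem mem_carryOut {init loc loc' : Assignment n ℓ} {L' : Fin n → Fin n} {i : Fin ℓ}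
    {p : Fin ℓ × Note n ℓ} : p ∈ carryOut init loc loc' L' i ↔
      ∃ w, loc w = i ∧ loc' w ≠ loc w ∧ p = (loc' w, .carry w (init w) (L' w)) := by
  rw [carryOut, mem_sendAll]
  refine exists_congr fun w => ?_
  by_cases h : loc w = i ∧ loc' w ≠ loc w
  · rw [if_pos h]
    simp only [Option.some.injEq]
    exact ⟨fun e => ⟨h.1, h.2, e.symm⟩, fun e => e.2.2.symm⟩
  · rw [if_neg h]
    simp only [reduceCtorEq, false_iff]
    tauto

theorem relocates_carryOut (init loc loc' : Assignment n ℓ) (L' : Fin n → Fin n) :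
    Relocates (carryOut init loc loc' L') loc loc' := by
  intro v
  constructor
  · intro p hp hv
    obtain ⟨w, -, -, rfl⟩ := mem_carryOut.1 hp
    cases hv
    rfl
  · intro h
    by_contra hne
    exact h _ (mem_carryOut.2 ⟨v, rfl, hne, rfl⟩) rfl

theorem carryOut_ne_nil {init loc loc' : Assignment n ℓ} {L' : Fin n → Fin n}
    (h : 0 < numMoved loc loc') : ∃ i, carryOut init loc loc' L' i ≠ [] := by
  by_contra! hc
  rw [← sum_length_carryOut init loc loc' L'] at h
  simp [hc] at h

/-- Travelling vertices arrive. -/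
theorem Shape.arrive (henc : Function.Injective enc) {c : (algorithm root cap enc).Config}
    {init : Assignment n ℓ} {ph : Bool} {loc loc' : Assignment n ℓ} {L' : Fin n → Fin n}
    {pend m mv cm}
    (h : Shape c (transit root init ph loc loc' L') (carryOut init loc loc' L') loc' pend m mv cm)
    (hpos : 0 < numMoved loc loc') :
    Shape c.next (canon root init ph loc' L') (fun _ => []) loc' pend m mv cm := by
  have key := h.next henc (carryOut_ne_nil hpos) (S' := canon root init ph loc' L')
    (out' := fun _ => []) (loc' := loc') (fun j => ?_) (relocates_self (by simp))
  · simpa using key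
  have hR : ∀ p ∈ received (carryOut init loc loc' L') j,
      ∃ w, loc' w = j ∧ loc' w ≠ loc w ∧ p = (loc w, .carry w (init w) (L' w)) := by
    rintro ⟨i, x⟩ hp
    obtain ⟨w, h1, h2, h3⟩ := mem_carryOut.1 hp
    obtain ⟨h4, h5⟩ := Prod.mk.inj h3
    exact ⟨w, h4.symm, h2, Prod.ext h1.symm h5⟩
  rw [handle_deliver]
  · have ho : ∀ w : Fin n, (pick fun p : Fin ℓ × Fin n =>
        ∃ i, (i, Note.cmd w p.1 p.2) ∈ received (carryOut init loc loc' L') j) = none := by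
      refine fun w => pick_eq_none ?_
      rintro ⟨d, l⟩ ⟨i, hp⟩
      obtain ⟨w', -, -, e⟩ := hR _ hp
      cases e
    have ha : ∀ w : Fin n, (pick fun p : Fin ℓ × Fin n =>
        ∃ i, (i, Note.carry w p.1 p.2) ∈ received (carryOut init loc loc' L') j) =
        if loc' w = j ∧ loc' w ≠ loc w then some (init w, L' w) else none := by
      intro w
      split_ifs with hw
      · refine pick_eq_some ⟨loc w, ?_⟩ ?_
        · exact mem_carryOut.2 ⟨w, rfl, hw.2, by rw [hw.1]⟩
        · rintro ⟨d, l⟩ ⟨i, hp⟩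
          obtain ⟨w', -, -, e⟩ := hR _ hp
          cases e
          rfl
      · refine pick_eq_none ?_
        rintro ⟨d, l⟩ ⟨i, hp⟩
        obtain ⟨w', h1, h2, e⟩ := hR _ hp
        cases e
        exact hw ⟨h1, h2⟩
    unfold deliver
    simp only [ho, ha, sendAll_none]
    unfold canon transit
    congr 2
    funext w
    unfold knowOf
    by_cases h1 : loc' w = loc w
    · simp [h1]
    · by_cases h2 : loc' w = j
      · simp [h2, h2 ▸ h1]
      · simp [h1, h2]
  · intro p hp
    obtain ⟨w, -, -, rfl⟩ := hR p hp
    exact id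
  · intro i u v w h' l hp
    obtain ⟨w', -, -, e⟩ := hR _ hp
    cases e

theorem mem_orders {loc loc' : Assignment n ℓ} {L' : Fin n → Fin n} {keep : Fin n → Prop}
    [DecidablePred keep] {i : Fin ℓ} {p : Fin ℓ × Note n ℓ} :
    p ∈ orders root loc loc' L' keep i ↔
      i = root ∧ ∃ w, ¬ keep w ∧ p = (loc w, .cmd w (loc' w) (L' w)) := by
  unfold orders
  split_ifs with hi
  · rw [mem_sendAll]
    simp only [hi, true_and]
    refine exists_congr fun w => ?_
    split_ifs with hk
    · simp [hk]
    · simp only [Option.some.injEq, hk, not_false_eq_true, true_and]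
      exact eq_comm
  · simp [hi]

theorem sum_length_orders (loc loc' : Assignment n ℓ) (L' : Fin n → Fin n) (keep : Fin n → Prop)
    [DecidablePred keep] : ∑ i, (orders root loc loc' L' keep i).length =
      (Finset.univ.filter fun w => ¬ keep w).card := by
  rw [Finset.sum_eq_single root]
  · rw [orders, if_pos rfl, length_sendAll]
    congr 1
    ext w
    by_cases hk : keep w <;> simp [hk]
  · intro i _ hi
    simp [orders, hi]
  · simp

/-- The orders of the root are executed. -/
theorem Shape.execute (henc : Function.Injective enc) {c : (algorithm root cap enc).Config}
    {init loc loc' : Assignment n ℓ} {L L' : Fin n → Fin n} {keep : Fin n → Prop}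
    [DecidablePred keep] {pend m mv cm}
    (h : Shape c (commanded root init loc loc' L L') (orders root loc loc' L' keep) loc pend m mv
      cm)
    (hkeep : ∀ w, keep w → loc' w = loc w ∧ L' w = L w) (hne : ∃ w, ¬ keep w) :
    Shape c.next (transit root init true loc loc' L') (carryOut init loc loc' L') loc' pend
      (m + numMoved loc loc') (mv + numMoved loc loc') cm := by
  have key := h.next henc (S' := transit root init true loc loc' L')
    (out' := carryOut init loc loc' L') (loc' := loc') ?_ (fun j => ?_)
    (relocates_carryOut init loc loc' L')
  · rwa [sum_length_carryOut] at key
  · obtain ⟨w, hw⟩ := hne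
    exact ⟨root, List.ne_nil_of_mem (mem_orders.2 ⟨rfl, w, hw, rfl⟩)⟩
  have hR : ∀ p ∈ received (orders root loc loc' L' keep) j,
      ∃ w, loc w = j ∧ ¬ keep w ∧ p = (root, .cmd w (loc' w) (L' w)) := by
    rintro ⟨i, x⟩ hp
    obtain ⟨h1, w, h2, h3⟩ := mem_orders.1 hp
    obtain ⟨h4, h5⟩ := Prod.mk.inj h3
    exact ⟨w, h4.symm, h2, Prod.ext h1 h5⟩
  rw [handle_deliver]
  · have ha : ∀ w : Fin n, (pick fun p : Fin ℓ × Fin n =>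
        ∃ i, (i, Note.carry w p.1 p.2) ∈ received (orders root loc loc' L' keep) j) = none := by
      refine fun w => pick_eq_none ?_
      rintro ⟨d, l⟩ ⟨i, hp⟩
      obtain ⟨w', -, -, e⟩ := hR _ hp
      cases e
    have ho : ∀ w : Fin n, (pick fun p : Fin ℓ × Fin n =>
        ∃ i, (i, Note.cmd w p.1 p.2) ∈ received (orders root loc loc' L' keep) j) =
        if loc w = j ∧ ¬ keep w then some (loc' w, L' w) else none := by
      intro w
      split_ifs with hw
      · refine pick_eq_some ⟨root, ?_⟩ ?_
        · exact mem_orders.2 ⟨rfl, w, hw.2, by rw [hw.1]⟩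
        · rintro ⟨d, l⟩ ⟨i, hp⟩
          obtain ⟨w', -, -, e⟩ := hR _ hp
          cases e
          rfl
      · refine pick_eq_none ?_
        rintro ⟨d, l⟩ ⟨i, hp⟩
        obtain ⟨w', h1, h2, e⟩ := hR _ hp
        cases e
        exact hw ⟨h1, h2⟩
    unfold deliver
    simp only [ho, ha]
    unfold commanded transit carryOut
    congr 1
    · simp only [true_and]
      congr 1
      funext w
      unfold knowOf
      by_cases h1 : loc w = j
      · by_cases h2 : keep w
        · simp [h1, h2, (hkeep w h2).1, (hkeep w h2).2]
        · by_cases h3 : loc' w = j <;> simp [h1, h2, h3]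
      · simp [h1]
    · congr 1
      funext w
      unfold knowOf
      by_cases h1 : loc w = j
      · by_cases h2 : keep w
        · simp [h1, h2, (hkeep w h2).1]
        · by_cases h3 : loc' w = j <;> simp [h1, h2, h3]
      · simp [h1]
  · intro p hp
    obtain ⟨w, -, -, rfl⟩ := hR p hp
    exact id
  · intro i u v w h' l hp
    obtain ⟨w', -, -, e⟩ := hR _ hp
    cases e

end Protocol

/-! ### Requests within one server, requests settled by the root, and decentralized moves -/

section Requests

variable {n ℓ B : ℕ} {root : Fin ℓ} {cap : ℕ} {enc : Note n ℓ → Fin (n ^ B)}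

/-- `c'` is reached from `c` through configurations that respect the capacities. -/
def Reaches {A : DistributedAlgorithm n ℓ B} (ε : ℝ) (c c' : A.Config) : Prop :=
  ∃ t, DistributedAlgorithm.Config.next^[t] c = c' ∧
    ∀ s ≤ t, Valid ε (DistributedAlgorithm.Config.next^[s] c).loc

theorem Reaches.refl {A : DistributedAlgorithm n ℓ B} {ε : ℝ} {c : A.Config}
    (h : Valid ε c.loc) : Reaches ε c c :=
  ⟨0, rfl, fun s hs => by obtain rfl := Nat.le_zero.1 hs; exact h⟩

theorem Reaches.head {A : DistributedAlgorithm n ℓ B} {ε : ℝ} {c c' : A.Config}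
    (h : Valid ε c.loc) (hr : Reaches ε c.next c') : Reaches ε c c' := by
  obtain ⟨t, ht, hv⟩ := hr
  refine ⟨t + 1, by rwa [Function.iterate_succ_apply], fun s hs => ?_⟩
  cases s with
  | zero => exact h
  | succ s =>
    rw [Function.iterate_succ_apply]
    exact hv s (by omega)

theorem Reaches.trans {A : DistributedAlgorithm n ℓ B} {ε : ℝ} {c c' c'' : A.Config}
    (h : Reaches ε c c') (h' : Reaches ε c' c'') : Reaches ε c c'' := by
  obtain ⟨t, ht, hv⟩ := h
  induction t generalizing c with
  | zero => obtain rfl : c = c' := ht; exact h'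
  | succ t ih =>
    refine Reaches.head (hv 0 (by omega)) (ih (by rwa [Function.iterate_succ_apply] at ht) ?_)
    intro s hs
    have := hv (s + 1) (by omega)
    rwa [Function.iterate_succ_apply] at this

theorem canon_know (root : Fin ℓ) (init : Assignment n ℓ) (ph : Bool) (loc : Assignment n ℓ)
    (L : Fin n → Fin n) (j : Fin ℓ) : (canon root init ph loc L j).know = knowOf init loc L j :=
  rfl

/-- Both endpoints belong to the same piece. -/
theorem Shape.request_same (henc : Function.Injective enc) {c : (algorithm root cap enc).Config}
    {init loc : Assignment n ℓ} {ph : Bool} {L : Fin n → Fin n} {u v pend m mv cm}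
    (h : Shape c (canon root init ph loc L) (fun _ => []) loc ((u, v) :: pend) m mv cm)
    (hc : Consistent L loc) (hL : L u = L v) :
    Shape c.next (canon root init ph loc L) (fun _ => []) loc pend m mv cm := by
  have hloc := hc u v hL
  have key := h.next_request henc (S' := canon root init ph loc L) (out' := fun _ => [])
    (fun j => ?_) (by simp)
  · simpa [hloc] using key
  · split_ifs with hj
    · have hj : loc u = j := by rcases hj with hj | hj <;> simp [hj, hloc]
      unfold onRequest
      simp only [canon_know, if_pos hloc, knowOf_label init L hj,
        knowOf_label init L (hloc ▸ hj : loc v = j), hL, if_true]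
    · exact handle_empty j _

/-- What a host does when two of its pieces are merged. -/
theorem onRequest_merge {init loc : Assignment n ℓ} {ph : Bool} {L : Fin n → Fin n} {u v : Fin n}
    (hL : L u ≠ L v) (hloc : loc u = loc v) :
    onRequest root (loc u) (canon root init ph loc L (loc u)) u v (loc u) (loc v) =
      (⟨ph, knowOf init loc (relabel L u v) (loc u),
        if ph = true ∧ loc u = root then some ⟨loc, init, L⟩ else none⟩,
        if ph then [(root, .fwd u v)] else []) := by
  unfold onRequest
  simp only [canon_know, if_pos hloc, knowOf_label init L rfl, knowOf_label init L hloc.symm,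
    if_neg hL, knowOf_relabel]
  rfl

/-- Two pieces on the same server are merged in the decentralized phase. -/
theorem Shape.request_merge (henc : Function.Injective enc)
    {c : (algorithm root cap enc).Config}
    {init loc : Assignment n ℓ} {L : Fin n → Fin n} {u v pend m mv cm}
    (h : Shape c (canon root init false loc L) (fun _ => []) loc ((u, v) :: pend) m mv cm)
    (hc : Consistent L loc) (hL : L u ≠ L v) (hloc : loc u = loc v) :
    Shape c.next (canon root init false loc (relabel L u v)) (fun _ => []) loc pend m mv cm := by
  have key := h.next_request henc (S' := canon root init false loc (relabel L u v))
    (out' := fun _ => []) (fun j => ?_) (by simp)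
  · simpa [hloc] using key
  · split_ifs with hj
    · obtain rfl : loc u = j := by rcases hj with hj | hj <;> simp [hj, hloc]
      rw [onRequest_merge hL hloc]
      simp [canon]
    · rw [handle_empty j _]
      simp only [canon, knowOf_relabel_of_ne init hc v (fun h => hj (Or.inl h))]
      simp

/-- Two pieces on the same server are merged in the centralized phase. -/
theorem Shape.request_merge_central (henc : Function.Injective enc) {ε : ℝ}
    {c : (algorithm root cap enc).Config}
    {init loc : Assignment n ℓ} {L : Fin n → Fin n} {u v pend m mv cm}
    (h : Shape c (canon root init true loc L) (fun _ => []) loc ((u, v) :: pend) m mv cm)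
    (hc : Consistent L loc) (hL : L u ≠ L v) (hloc : loc u = loc v) (hv : Valid ε loc) :
    ∃ c', Reaches ε c c' ∧
      Shape c' (canon root init true loc (relabel L u v)) (fun _ => []) loc pend (m + 1) mv cm := by
  let out : Fin ℓ → List (Fin ℓ × Note n ℓ) := fun j =>
    if j = loc u then [(root, .fwd u v)] else []
  have h1 := h.next_request henc (out' := out)
    (S' := fun j => ⟨true, knowOf init loc (relabel L u v) j,
      if j = root then some ⟨loc, init, L⟩ else none⟩) (fun j => ?_) ?_
  · rw [Finset.sum_eq_single (loc u) (by intro j _ hj; simp [out, hj]) (by simp)] at h1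
    have h2 := h1.next henc ⟨loc u, by simp [out]⟩
      (S' := canon root init true loc (relabel L u v)) (out' := fun _ => []) (loc' := loc)
      (fun j => ?_) (relocates_self (by simp))
    · refine ⟨_, Reaches.head (h.loc ▸ hv) (Reaches.head (h1.loc ▸ hv)
        (Reaches.refl (h2.loc ▸ hv))), ?_⟩
      simpa [out, hloc] using h2
    · by_cases hj : j = root
      · subst hj
        have hR : received out j = {(loc u, .fwd u v)} := by
          ext ⟨i, x⟩
          by_cases hi : i = loc u <;> simp [received, out, hi]
        unfold handle
        rw [hR]
        dsimp only
        rw [pick_trigger (x := .fwd u v) trivial]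
        simp [onFwd, canon, hloc]
      · have hR : received out j = ∅ := by
          ext ⟨i, x⟩
          by_cases hi : i = loc u <;> simp [received, out, hi, hj]
        rw [hR, handle_empty]
        simp [canon, hj]
  · by_cases hj : loc u = j ∨ loc v = j
    · rw [if_pos hj]
      obtain rfl : loc u = j := by rcases hj with hj | hj <;> simp [hj, hloc]
      rw [onRequest_merge hL hloc]
      simp [out]
    · rw [if_neg hj, handle_empty j _]
      have hj' : j ≠ loc u := fun h => hj (Or.inl h.symm)
      simp only [canon, out, if_neg hj', knowOf_relabel_of_ne init hc v hj'.symm]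
      simp
  · intro j p hp
    simp only [out] at hp
    split_ifs at hp
    · rw [List.mem_singleton.1 hp]; rfl
    · cases hp

open Classical in
/-- A request between different servers in the centralized phase. -/
theorem Shape.request_central (henc : Function.Injective enc) {ε : ℝ}
    {c : (algorithm root cap enc).Config}
    {init loc loc' : Assignment n ℓ} {L L' : Fin n → Fin n} {u v pend m mv cm}
    (h : Shape c (canon root init true loc L) (fun _ => []) loc ((u, v) :: pend) m mv cm)
    (hloc : loc u ≠ loc v) (ho : centralPlan cap ⟨loc, init, L⟩ u v = ⟨loc', init, L'⟩)
    (hv : Valid ε loc) (hv' : Valid ε loc') (hpos : 0 < numMoved loc loc') :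
    ∃ c', Reaches ε c c' ∧
      Shape c' (canon root init true loc' L') (fun _ => []) loc' pend
        (m + 1 + (Finset.univ.filter fun w => ¬ (loc' w = loc w ∧ L' w = L w)).card +
          numMoved loc loc') (mv + numMoved loc loc') (cm + 1) := by
  let out : Fin ℓ → List (Fin ℓ × Note n ℓ) := fun j =>
    if j = loc u then [(root, .fwd u v)] else []
  have h1 := h.next_request henc (out' := out) (S' := canon root init true loc L)
    (fun j => ?_) ?_
  · rw [Finset.sum_eq_single (loc u) (by intro j _ hj; simp [out, hj]) (by simp)] at h1
    have h2 := h1.next henc ⟨loc u, by simp [out]⟩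
      (S' := commanded root init loc loc' L L')
      (out' := orders root loc loc' L' fun w => loc' w = loc w ∧ L' w = L w) (loc' := loc)
      (fun j => ?_) (relocates_self ?_)
    -- A moved vertex receives an order, so messages are in transit and the next round is not a
    -- request round.
    · have hex : ∃ w, ¬ (loc' w = loc w ∧ L' w = L w) := by
        obtain ⟨w, hw⟩ := Finset.card_pos.1 hpos
        rw [Finset.mem_filter] at hw
        exact ⟨w, fun h => hw.2 h.1.symm⟩
      have h3 := h2.execute henc (fun w hw => hw) hex
      have h4 := h3.arrive henc hpos
      refine ⟨_, Reaches.head (h.loc ▸ hv) (Reaches.head (h1.loc ▸ hv) (Reaches.head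
        (h2.loc ▸ hv) (Reaches.head (h3.loc ▸ hv') (Reaches.refl (h4.loc ▸ hv'))))), ?_⟩
      rw [sum_length_orders] at h4
      simpa [out, hloc] using h4
    · by_cases hj : j = root
      · subst hj
        have hR : received out j = {(loc u, .fwd u v)} := by
          ext ⟨i, x⟩
          by_cases hi : i = loc u <;> simp [received, out, hi]
        unfold handle
        rw [hR]
        dsimp only
        rw [pick_trigger (x := .fwd u v) trivial]
        simp only [onFwd, canon, and_self, if_true, ho, if_neg hloc, commanded, orders]
      · have hR : received out j = ∅ := by
          ext ⟨i, x⟩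
          by_cases hi : i = loc u <;> simp [received, out, hi, hj]
        rw [hR, handle_empty]
        simp [canon, commanded, orders, hj]
    · intro j p hp
      obtain ⟨-, w, -, rfl⟩ := mem_orders.1 hp
      rfl
  · split_ifs with hj
    · unfold onRequest
      simp only [canon, if_neg hloc, if_true, out]
    · rw [handle_empty j _]
      have hj' : j ≠ loc u := fun h => hj (Or.inl h.symm)
      simp [out, hj']
  · intro j p hp
    simp only [out] at hp
    split_ifs at hp
    · rw [List.mem_singleton.1 hp]; rfl
    · cases hp

/-! ### Requests between different servers in the decentralized phase -/

/-- The message that the host `j` of `x` sends to the other host `i`. -/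
def statNote (init loc : Assignment n ℓ) (L : Fin n → Fin n) (u v x : Fin n) (j i : Fin ℓ) :
    Note n ℓ :=
  .stat u v (L x) (Fin.ofNat _ (classSize L x)) (Fin.ofNat _ (homeCount init L x j))
    (Fin.ofNat _ (homeCount init L x i)) (Fin.ofNat _ (load loc j))

/-- The messages that the hosts exchange. -/
def exchange (init loc : Assignment n ℓ) (L : Fin n → Fin n) (u v : Fin n) (j : Fin ℓ) :
    List (Fin ℓ × Note n ℓ) :=
  if j = loc u then [(loc v, statNote init loc L u v u (loc u) (loc v))]
  else if j = loc v then [(loc u, statNote init loc L u v v (loc v) (loc u))]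
  else []

/-- The decision about a request between different servers. -/
def decision (cap : ℕ) (init loc : Assignment n ℓ) (L : Fin n → Fin n) (u v : Fin n) :
    Option Bool :=
  verdict cap (classSize L u) (classSize L v)
    (homeCount init L u (loc u) + homeCount init L v (loc u))
    (homeCount init L u (loc v) + homeCount init L v (loc v)) (load loc (loc u))
    (load loc (loc v))

/-- One message each way gives both hosts the same data, so both can evaluate `decision` without
further agreement. -/
theorem Shape.request_exchange (henc : Function.Injective enc)
    {c : (algorithm root cap enc).Config}
    {init loc : Assignment n ℓ} {L : Fin n → Fin n} {u v pend m mv cm}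
    (h : Shape c (canon root init false loc L) (fun _ => []) loc ((u, v) :: pend) m mv cm)
    (hc : Consistent L loc) (hloc : loc u ≠ loc v) :
    Shape c.next (canon root init false loc L) (exchange init loc L u v) loc pend (m + 2) mv
      (cm + 1) := by
  have key := h.next_request henc (S' := canon root init false loc L)
    (out' := exchange init loc L u v) (fun j => ?_) ?_
  · have hs : ∑ j, (exchange init loc L u v j).length = 2 := by
      rw [Finset.sum_eq_add (loc u) (loc v) hloc]
      · simp [exchange, hloc.symm]
      · intro j _ hj
        simp [exchange, hj.1, hj.2]
      · simp
      · simp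
    rwa [hs, if_neg hloc] at key
  · split_ifs with hj
    · unfold onRequest
      simp only [canon, if_neg hloc, Bool.false_eq_true, if_false, exchange, statNote]
      by_cases hju : j = loc u
      · subst hju
        simp only [if_true, knowOf_label init L rfl, knowOf_size init hc rfl,
          knowOf_home init hc rfl, knowOf_load]
      · have hjv : j = loc v := by
          rcases hj with hj | hj
          · exact absurd hj.symm hju
          · exact hj.symm
        subst hjv
        simp only [if_neg hju, if_true, knowOf_label init L rfl, knowOf_size init hc rfl,
          knowOf_home init hc rfl, knowOf_load]
    · rw [handle_empty j _]
      push Not at hj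
      simp [exchange, Ne.symm hj.1, Ne.symm hj.2]
  · intro j p hp
    simp only [exchange] at hp
    split_ifs at hp
    · rw [List.mem_singleton.1 hp]; rfl
    · rw [List.mem_singleton.1 hp]; rfl
    · cases hp

theorem received_exchange_left {init loc : Assignment n ℓ} {L : Fin n → Fin n} {u v : Fin n}
    (hloc : loc u ≠ loc v) : received (exchange init loc L u v) (loc u) =
      {(loc v, statNote init loc L u v v (loc v) (loc u))} := by
  ext ⟨i, x⟩
  simp only [received, exchange, Set.mem_ofPred_eq, Set.mem_singleton_iff]
  by_cases hu : i = loc u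
  · simp [hu, hloc]
  · by_cases hv : i = loc v
    · simp [hv, hloc.symm]
    · simp [hu, hv]

theorem received_exchange_right {init loc : Assignment n ℓ} {L : Fin n → Fin n} {u v : Fin n}
    (hloc : loc u ≠ loc v) : received (exchange init loc L u v) (loc v) =
      {(loc u, statNote init loc L u v u (loc u) (loc v))} := by
  ext ⟨i, x⟩
  simp only [received, exchange, Set.mem_ofPred_eq, Set.mem_singleton_iff]
  by_cases hu : i = loc u
  · simp [hu]
  · by_cases hv : i = loc v
    · simp [hv, hloc.symm]
    · simp [hu, hv]

theorem received_exchange_other {init loc : Assignment n ℓ} {L : Fin n → Fin n} {u v : Fin n}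
    {j : Fin ℓ} (hu : j ≠ loc u) (hv : j ≠ loc v) :
    received (exchange init loc L u v) j = ∅ := by
  ext ⟨i, x⟩
  simp only [received, exchange, Set.mem_ofPred_eq, Set.mem_empty_iff_false, iff_false]
  by_cases hu' : i = loc u
  · simp [hu', hv]
  · by_cases hv' : i = loc v
    · rw [if_neg hu', if_pos hv']
      simp [hu]
    · simp [hu', hv']

/-- The host of `u` alone raises the alarm, so every server receives it exactly once. -/
theorem handle_exchange_left {init loc : Assignment n ℓ} {L : Fin n → Fin n} {u v : Fin n}
    (hc : Consistent L loc) (hloc : loc u ≠ loc v) :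
    handle root cap (loc u) (canon root init false loc L (loc u)) none
      (received (exchange init loc L u v) (loc u)) =
    match decision cap init loc L u v with
    | some true => sendPiece (canon root init false loc L (loc u)) (L u) (loc v) (L v)
    | some false => (canon root init false loc L (loc u), [])
    | none => (canon root init false loc L (loc u),
        (List.finRange ℓ).map fun d => (d, .alarm u v)) := by
  rw [received_exchange_left hloc]
  unfold handle
  dsimp only
  rw [pick_trigger (x := statNote init loc L u v v (loc v) (loc u)) trivial]
  simp only [statNote, onStat]
  have e1 : (canon root init false loc L (loc u)).know = knowOf init loc L (loc u) := rfl
  rw [e1, if_pos ((knowOf_isSome init loc L (loc u) u).2 rfl)]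
  simp only [knowOf_label init L rfl, knowOf_size init hc rfl, knowOf_home init hc rfl,
    knowOf_load, val_ofNat (classSize_le L v), val_ofNat (load_le loc (loc v)),
    val_ofNat ((homeCount_le init L v _).trans (classSize_le L v))]
  rfl

theorem handle_exchange_right {init loc : Assignment n ℓ} {L : Fin n → Fin n} {u v : Fin n}
    (hc : Consistent L loc) (hloc : loc u ≠ loc v) :
    handle root cap (loc v) (canon root init false loc L (loc v)) none
      (received (exchange init loc L u v) (loc v)) =
    match decision cap init loc L u v with
    | some false => sendPiece (canon root init false loc L (loc v)) (L v) (loc u) (L u)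
    | _ => (canon root init false loc L (loc v), []) := by
  rw [received_exchange_right hloc]
  unfold handle
  dsimp only
  rw [pick_trigger (x := statNote init loc L u v u (loc u) (loc v)) trivial]
  simp only [statNote, onStat]
  have e1 : (canon root init false loc L (loc v)).know = knowOf init loc L (loc v) := rfl
  rw [e1, if_neg (by rw [knowOf_isSome]; exact hloc)]
  simp only [knowOf_label init L rfl, knowOf_size init hc rfl, knowOf_home init hc rfl,
    knowOf_load, val_ofNat (classSize_le L u), val_ofNat (load_le loc (loc u)),
    val_ofNat ((homeCount_le init L u _).trans (classSize_le L u))]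
  rfl

theorem shift_ne_iff {loc : Assignment n ℓ} {L : Fin n → Fin n} (hc : Consistent L loc)
    {a b : Fin n} (hloc : loc a ≠ loc b) (w : Fin n) :
    shift loc L a b w ≠ loc w ↔ L w = L a := by
  unfold shift
  by_cases hw : L w = L a
  · simp [hw, hc w a hw, hloc.symm]
  · simp [hw]

theorem sendPiece_canon {init loc : Assignment n ℓ} {L : Fin n → Fin n} {a b : Fin n}
    (hc : Consistent L loc) (hloc : loc a ≠ loc b) :
    sendPiece (canon root init false loc L (loc a)) (L a) (loc b) (L b) =
      (transit root init false loc (shift loc L a b) (relabel L a b) (loc a),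
        carryOut init loc (shift loc L a b) (relabel L a b) (loc a)) := by
  unfold sendPiece canon transit carryOut
  congr 2
  · funext w
    have h := shift_ne_iff hc hloc w
    unfold knowOf
    by_cases hw : L w = L a
    · have h' := h.2 hw
      rw [if_neg (fun h2 => h' h2.2 : ¬ (loc w = loc a ∧ shift loc L a b w = loc w))]
      simp [hw, hc w a hw]
    · have h' : shift loc L a b w = loc w := by
        by_contra hne; exact hw (h.1 hne)
      by_cases hl : loc w = loc a <;> simp [hw, hl, h', relabel]
  · funext w
    have h := shift_ne_iff hc hloc w
    unfold knowOf
    by_cases hw : L w = L a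
    · have h' := h.2 hw
      simp [hw, hc w a hw, relabel, shift, hloc.symm]
    · have h' : shift loc L a b w = loc w := by
        by_contra hne; exact hw (h.1 hne)
      by_cases hl : loc w = loc a <;> simp [hw, hl, h']

/-- Even the receiving server changes nothing yet: the class of `b` keeps its label, and the
travelling vertices carry that label with them. -/
theorem transit_shift_of_ne {init loc : Assignment n ℓ} {L : Fin n → Fin n} {a b : Fin n}
    (hc : Consistent L loc) {j : Fin ℓ} (hj : j ≠ loc a) :
    (canon root init false loc L j, ([] : List (Fin ℓ × Note n ℓ))) =
      (transit root init false loc (shift loc L a b) (relabel L a b) j,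
        carryOut init loc (shift loc L a b) (relabel L a b) j) := by
  have hw : ∀ w, loc w = j → shift loc L a b w = loc w ∧ L w ≠ L a := fun w hw => by
    have h1 : L w ≠ L a := fun h => hj (hw.symm.trans (hc w a h))
    exact ⟨by simp [shift, h1], h1⟩
  congr 1
  · unfold canon transit knowOf
    congr 1
    funext w
    by_cases h : loc w = j
    · simp [h, relabel, (hw w h).2, shift]
    · simp [h]
  · rw [carryOut, ← sendAll_none (n := n)]
    congr 1
    funext w
    by_cases h : loc w = j
    · simp [(hw w h).1]
    · simp [h]

/-- A piece is moved in the decentralized phase. -/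
theorem Shape.request_join (henc : Function.Injective enc) {ε : ℝ}
    {c : (algorithm root cap enc).Config}
    {init loc : Assignment n ℓ} {L : Fin n → Fin n} {u v a b : Fin n} {pend m mv cm}
    (h : Shape c (canon root init false loc L) (fun _ => []) loc ((u, v) :: pend) m mv cm)
    (hc : Consistent L loc) (hloc : loc u ≠ loc v)
    (hd : decision cap init loc L u v = some true ∧ a = u ∧ b = v ∨
      decision cap init loc L u v = some false ∧ a = v ∧ b = u)
    (hv : Valid ε loc) (hv' : Valid ε (shift loc L a b)) :
    ∃ c', Reaches ε c c' ∧
      Shape c' (canon root init false (shift loc L a b) (relabel L a b)) (fun _ => [])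
        (shift loc L a b) pend (m + 2 + numMoved loc (shift loc L a b))
        (mv + numMoved loc (shift loc L a b)) (cm + 1) := by
  have hab : loc a ≠ loc b := by
    rcases hd with ⟨-, rfl, rfl⟩ | ⟨-, rfl, rfl⟩
    · exact hloc
    · exact hloc.symm
  have h1 := h.request_exchange henc hc hloc
  have h2 := h1.next henc ⟨loc u, by simp [exchange]⟩
    (S' := transit root init false loc (shift loc L a b) (relabel L a b))
    (out' := carryOut init loc (shift loc L a b) (relabel L a b)) (fun j => ?_)
    (relocates_carryOut _ _ _ _)
  · have hpos : 0 < numMoved loc (shift loc L a b) := by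
      rw [numMoved_shift hc hab]; exact classSize_pos L a
    have h3 := h2.arrive henc hpos
    rw [sum_length_carryOut] at h3
    exact ⟨_, Reaches.head (h.loc ▸ hv) (Reaches.head (h1.loc ▸ hv) (Reaches.head
        (h2.loc ▸ hv') (Reaches.refl (h3.loc ▸ hv')))), h3⟩
  · by_cases hju : j = loc u
    · subst hju
      rw [handle_exchange_left hc hloc]
      rcases hd with ⟨hd, rfl, rfl⟩ | ⟨hd, rfl, rfl⟩
      · rw [hd]; exact sendPiece_canon hc hab
      · rw [hd]; exact transit_shift_of_ne hc hloc
    · by_cases hjv : j = loc v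
      · subst hjv
        rw [handle_exchange_right hc hloc]
        rcases hd with ⟨hd, rfl, rfl⟩ | ⟨hd, rfl, rfl⟩
        · rw [hd]; exact transit_shift_of_ne hc hju
        · rw [hd]; exact sendPiece_canon hc hab
      · rw [received_exchange_other hju hjv, handle_empty]
        refine transit_shift_of_ne hc ?_
        rcases hd with ⟨-, rfl, rfl⟩ | ⟨-, rfl, rfl⟩
        · exact hju
        · exact hjv

end Requests

/-! ### The switch to the centralized phase -/

section Overload

variable {n ℓ B : ℕ} {root : Fin ℓ} {cap : ℕ} {enc : Note n ℓ → Fin (n ^ B)}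

/-- The reports of the servers to the root. -/
def reports (root : Fin ℓ) (init loc : Assignment n ℓ) (L : Fin n → Fin n) (u v : Fin n)
    (i : Fin ℓ) : List (Fin ℓ × Note n ℓ) :=
  sendAll fun w => if loc w = i then some (root, .info u v w (init w) (L w)) else none

theorem mem_reports {init loc : Assignment n ℓ} {L : Fin n → Fin n} {u v : Fin n}
    {i : Fin ℓ} {p : Fin ℓ × Note n ℓ} : p ∈ reports root init loc L u v i ↔
      ∃ w, loc w = i ∧ p = (root, .info u v w (init w) (L w)) := by
  rw [reports, mem_sendAll]
  refine exists_congr fun w => ?_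
  by_cases h : loc w = i
  · simp [h, eq_comm]
  · simp [h]

theorem sum_length_reports (init loc : Assignment n ℓ) (L : Fin n → Fin n) (u v : Fin n) :
    ∑ i, (reports root init loc L u v i).length = n := by
  simp only [reports, length_sendAll]
  have h := Finset.card_eq_sum_card_fiberwise (s := (Finset.univ : Finset (Fin n))) (f := loc)
    (t := Finset.univ) (fun _ _ => Finset.mem_coe.2 (Finset.mem_univ _))
  rw [Finset.card_univ, Fintype.card_fin] at h
  refine Eq.trans ?_ h.symm
  refine Finset.sum_congr rfl fun i _ => ?_
  congr 1
  ext w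
  by_cases hw : loc w = i <;> simp [hw]

/-- Each vertex is reported by its host only, so `pick` has a single candidate, and the sender
reveals the location. -/
theorem overviewOf_reports (init loc : Assignment n ℓ) (L : Fin n → Fin n) (u v : Fin n) :
    overviewOf root u v (received (reports root init loc L u v) root) = ⟨loc, init, L⟩ := by
  have h : ∀ w : Fin n, (pick fun p : Fin ℓ × Fin ℓ × Fin n =>
      (p.1, Note.info u v w p.2.1 p.2.2) ∈ received (reports root init loc L u v) root) =
        some (loc w, init w, L w) := by
    intro w
    refine pick_eq_some (mem_reports.2 ⟨w, rfl, rfl⟩) ?_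
    rintro ⟨i, h, l⟩ hp
    obtain ⟨w', h1, h2⟩ := mem_reports.1 hp
    cases h2
    exact Prod.ext h1.symm rfl
  unfold overviewOf
  simp only [h, Option.getD_some]

/-- A request between different servers in the decentralized phase whose pieces do not fit: the
vertices are rearranged and the centralized phase begins. -/
theorem Shape.request_overload (henc : Function.Injective enc) {ε : ℝ}
    {c : (algorithm root cap enc).Config}
    {init loc : Assignment n ℓ} {L : Fin n → Fin n} {u v : Fin n} {pend m mv cm}
    (h : Shape c (canon root init false loc L) (fun _ => []) loc ((u, v) :: pend) m mv cm)
    (hc : Consistent L loc) (hloc : loc u ≠ loc v)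
    (hd : decision cap init loc L u v = none)
    (hv : Valid ε loc) (hv' : Valid ε (reset loc (relabel L u v)))
    (hpos : 0 < numMoved loc (reset loc (relabel L u v))) :
    ∃ c', Reaches ε c c' ∧
      Shape c' (canon root init true (reset loc (relabel L u v)) (relabel L u v)) (fun _ => [])
        (reset loc (relabel L u v)) pend
        (m + 2 + ℓ + n + n + numMoved loc (reset loc (relabel L u v)))
        (mv + numMoved loc (reset loc (relabel L u v))) (cm + 1) := by
  have h1 := h.request_exchange henc hc hloc
  let out : Fin ℓ → List (Fin ℓ × Note n ℓ) := fun j =>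
    if j = loc u then (List.finRange ℓ).map fun d => (d, .alarm u v) else []
  have h2 := h1.next henc ⟨loc u, by simp [exchange]⟩ (S' := canon root init false loc L)
    (out' := out) (loc' := loc) (fun j => ?_) (relocates_self ?_)
  · rw [Finset.sum_eq_single (loc u) (by intro j _ hj; simp [out, hj]) (by simp)] at h2
    have hout : (out (loc u)).length = ℓ := by simp [out]
    rw [hout, numMoved_self] at h2
    have h3 := h2.next henc ⟨loc u, fun e => by
        have := (loc u).2; rw [e] at hout; simp at hout; omega⟩
      (S' := fun j => ⟨true, knowOf init loc L j, none⟩)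
      (out' := reports root init loc L u v) (loc' := loc) (fun j => ?_) (relocates_self ?_)
    · rw [sum_length_reports, numMoved_self] at h3
      have h4 := h3.next henc
        ⟨loc u, List.ne_nil_of_mem (mem_reports.2 ⟨u, rfl, rfl⟩)⟩
        (S' := commanded root init loc (reset loc (relabel L u v)) L (relabel L u v))
        (out' := orders root loc (reset loc (relabel L u v)) (relabel L u v) fun _ => False)
        (loc' := loc) (fun j => ?_) (relocates_self ?_)
      · have h5 := h4.execute henc (fun w hw => hw.elim) ⟨u, id⟩
        have h6 := h5.arrive henc hpos
        refine ⟨_, Reaches.head (h.loc ▸ hv) (Reaches.head (h1.loc ▸ hv) (Reaches.head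
          (h2.loc ▸ hv) (Reaches.head (h3.loc ▸ hv) (Reaches.head (h4.loc ▸ hv) (Reaches.head
            (h5.loc ▸ hv') (Reaches.refl (h6.loc ▸ hv'))))))), ?_⟩
        rw [sum_length_orders] at h6
        simpa using h6
      · by_cases hj : j = root
        · subst hj
          rw [handle_info (u := u) (v := v)]
          · unfold onInfo
            simp only [overviewOf_reports, commanded, orders, if_true]
            simp
          · rintro ⟨i, x⟩ hp
            obtain ⟨w, -, h2⟩ := mem_reports.1 hp
            exact ⟨w, _, _, (Prod.mk.inj h2).2⟩
          · exact ⟨(loc u, _), mem_reports.2 ⟨u, rfl, rfl⟩⟩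
        · have hR : received (reports root init loc L u v) j = ∅ := by
            ext ⟨i, x⟩
            simp only [Set.mem_empty_iff_false, iff_false]
            intro hp
            obtain ⟨w, -, h2⟩ := mem_reports.1 hp
            exact hj (Prod.mk.inj h2).1
          rw [hR, handle_empty]
          simp [commanded, orders, hj]
      · intro j p hp
        obtain ⟨-, w, -, rfl⟩ := mem_orders.1 hp
        rfl
    · have hR : received out j = {(loc u, .alarm u v)} := by
        ext ⟨i, x⟩
        by_cases hi : i = loc u
        · simp [received, out, hi, eq_comm]
        · simp [received, out, hi]
      unfold handle
      rw [hR]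
      dsimp only
      rw [pick_trigger (x := .alarm u v) trivial]
      simp only [onAlarm, canon_know, reports]
      congr 2
      funext w
      by_cases hw : loc w = j <;> simp [knowOf, hw]
    · intro j p hp
      obtain ⟨w, -, rfl⟩ := mem_reports.1 hp
      rfl
  · by_cases hju : j = loc u
    · subst hju
      rw [handle_exchange_left hc hloc, hd]
      simp [out]
    · by_cases hjv : j = loc v
      · subst hjv
        rw [handle_exchange_right hc hloc, hd]
        simp [out, hju]
      · rw [received_exchange_other hju hjv, handle_empty]
        simp [out, hju]
  · intro j p hp
    simp only [out] at hp
    split_ifs at hp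
    · obtain ⟨d, -, rfl⟩ := List.mem_map.1 hp
      rfl
    · cases hp

end Overload

/-! ### Analysis -/

section Analysis

variable {n ℓ : ℕ}

/-- The capacity of a server. -/
noncomputable def capacity (n ℓ : ℕ) (ε : ℝ) : ℕ := ⌊(1 + ε) * n / ℓ⌋₊

theorem le_capacity_iff {ε : ℝ} (hε : 0 < ε) {x : ℕ} :
    x ≤ capacity n ℓ ε ↔ (x : ℝ) ≤ (1 + ε) * n / ℓ :=
  Nat.le_floor_iff (by positivity)

theorem valid_shift {ε : ℝ} (hε : 0 < ε) {loc : Assignment n ℓ} {L : Fin n → Fin n}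
    (hc : Consistent L loc) {a b : Fin n} (hloc : loc a ≠ loc b) (hv : Valid ε loc)
    (hfit : load loc (loc b) + classSize L a ≤ capacity n ℓ ε) : Valid ε (shift loc L a b) := by
  intro j
  by_cases hj : j = loc b
  · rw [hj, load_shift_self hc hloc]
    exact (le_capacity_iff hε).1 hfit
  · have : (load (shift loc L a b) j : ℝ) ≤ load loc j := by
      exact_mod_cast load_shift_of_ne loc L hj
    exact this.trans (hv j)

theorem decision_true {cap : ℕ} {init loc : Assignment n ℓ} {L : Fin n → Fin n} {u v : Fin n}
    (h : decision cap init loc L u v = some true) :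
    Joins init loc L u v ∧ load loc (loc v) + classSize L u ≤ cap := by
  unfold decision verdict at h
  split_ifs at h with h1 h2
  · exact ⟨h1, h2⟩
  · cases h

/-- The failure of the rule for (u, v) implies the rule for (v, u): no 7/8 majority at the host of
`v`, and either one at the host of `u` or the class of `v` is the smaller one. -/
theorem decision_false {cap : ℕ} {init loc : Assignment n ℓ} {L : Fin n → Fin n} {u v : Fin n}
    (h : decision cap init loc L u v = some false) :
    Joins init loc L v u ∧ load loc (loc u) + classSize L v ≤ cap := by
  unfold decision verdict at h
  split_ifs at h with h1 h2 h2
  · cases h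
  · refine ⟨?_, h2⟩
    unfold Joins
    omega

theorem decision_none {cap : ℕ} {init loc : Assignment n ℓ} {L : Fin n → Fin n} {u v : Fin n}
    (h : decision cap init loc L u v = none) :
    Joins init loc L u v ∧ cap < load loc (loc v) + classSize L u ∨
      Joins init loc L v u ∧ cap < load loc (loc u) + classSize L v := by
  unfold decision verdict at h
  split_ifs at h with h1 h2 h2
  · exact Or.inl ⟨h1, by omega⟩
  · refine Or.inr ⟨?_, by omega⟩
    unfold Joins
    omega

/-- An overload in the decentralized phase shows that many vertices have to move. -/
theorem MajorityInv.overload {ε : ℝ} (hε : 0 < ε) (hℓ : 0 < ℓ) {init f loc : Assignment n ℓ}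
    {L : Fin n → Fin n} {w : Fin n → ℕ} (hi : MajorityInv init f loc L w)
    (hinit : PerfectlyBalanced init) {a b : Fin n} (hab : L a ≠ L b) (hloc : loc a ≠ loc b)
    (hf : Consistent L f) (hfab : f a = f b) (hj : Joins init loc L a b)
    (hfull : capacity n ℓ ε < load loc (loc b) + classSize L a) :
    ε * n / ℓ < 8 * numMoved init f := by
  -- The invariant does not mention capacities, so it applies to the join that is not carried out.
  have h1 := (hi.join hab hloc hf hfab hj).load_le (hf.relabel hfab) (loc b)
  rw [load_shift_self hi.coll hloc] at h1
  have h2 : (1 + ε) * n / ℓ < (load loc (loc b) + classSize L a : ℕ) := by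
    by_contra! h
    exact absurd ((le_capacity_iff hε).2 h) (by omega)
  have h3 : ((load loc (loc b) + classSize L a : ℕ) : ℝ) ≤ load init (loc b) +
    8 * numMoved init f := by exact_mod_cast h1
  rw [hinit.load_eq hℓ] at h3
  have h4 : (1 + ε) * n / ℓ = n / ℓ + ε * n / ℓ := by ring
  linarith

/-- Two pieces from different servers cannot meet unless one of them leaves its server entirely. -/
theorem classSize_le_numMoved {loc loc' : Assignment n ℓ} {L : Fin n → Fin n}
    (hc : Consistent L loc) (hc' : Consistent L loc') {a b : Fin n} (hloc : loc a ≠ loc b)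
    (hloc' : loc' a = loc' b) (hle : classSize L a ≤ classSize L b) :
    classSize L a ≤ numMoved loc loc' := by
  have key : ∀ x, loc x ≠ loc' x → classSize L x ≤ numMoved loc loc' := by
    intro x hx
    rw [classSize_eq_card]
    refine Finset.card_le_card fun w hw => ?_
    simp only [Finset.mem_filter, Finset.mem_univ, true_and] at hw ⊢
    rwa [hc w x hw, hc' w x hw]
  by_cases h : loc a = loc' a
  · exact hle.trans (key b fun h' => hloc (h.trans (hloc'.trans h'.symm)))
  · exact key a h

/-- This bounds the orders of the root: a vertex without a new server changes its label only if it
belongs to the class of `a`. -/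
theorem card_changed_le {loc loc' : Assignment n ℓ} {L : Fin n → Fin n} {a b : Fin n}
    [DecidablePred fun w => ¬ (loc' w = loc w ∧ relabel L a b w = L w)] :
    (Finset.univ.filter fun w => ¬ (loc' w = loc w ∧ relabel L a b w = L w)).card ≤
      classSize L a + numMoved loc loc' := by
  rw [classSize_eq_card]
  refine le_trans (Finset.card_le_card fun w => ?_) (Finset.card_union_le _ _)
  simp only [Finset.mem_filter, Finset.mem_univ, true_and, Finset.mem_union]
  intro h
  by_contra! h'
  exact h ⟨h'.2.symm, by simp [relabel, h'.1]⟩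

/-! ### Accounting between requests -/

variable {B : ℕ} {root : Fin ℓ} {enc : Note n ℓ → Fin (n ^ B)}

/-- The costs in the decentralized phase. -/
def DecentralCosts (I : Instance n ℓ) (f loc : Assignment n ℓ) (L : Fin n → Fin n)
    (m mv : ℕ) : Prop :=
  ∃ w, MajorityInv I.init f loc L w ∧ mv = ∑ v, w v ∧ m ≤ 3 * mv

/-- The costs in the centralized phase. -/
def CentralCosts (I : Instance n ℓ) (ε : ℝ) (f loc : Assignment n ℓ) (L : Fin n → Fin n)
    (m mv : ℕ) : Prop :=
  ε * n / ℓ < 8 * numMoved I.init f ∧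
    (∃ prev R s, CentralInv ε I.init loc L
      (80 * (numMoved I.init f * Nat.log 2 n) + 2 * n) (numMoved I.init f) mv prev R s) ∧
    m + (Finset.univ.image L).card ≤ 9 * mv + n ∧ n ≤ 2 * mv

/-- The invariant between two requests; the requests in `σ` have been processed. -/
structure IdleInv (I : Instance n ℓ) (ε : ℝ) (f : Assignment n ℓ)
    (c : (algorithm root (capacity n ℓ ε) enc).Config) (ph : Bool) (loc : Assignment n ℓ)
    (L : Fin n → Fin n) (σ pend : List (Fin n × Fin n)) (m mv cm : ℕ) : Prop where
  shape : Shape c (canon root I.init ph loc L) (fun _ => []) loc pend m mv cm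
  requests : I.requests = σ ++ pend
  tracks : I.Tracks L σ
  valid : Valid ε loc
  coll : Consistent L loc
  comm : cm ≤ mv
  costs : if ph then CentralCosts I ε f loc L m mv else DecentralCosts I f loc L m mv

theorem IdleInv.step_decentral (henc : Function.Injective enc) {I : Instance n ℓ} {ε : ℝ}
    (hε : 0 < ε) (hn : 2 ≤ n) (hℓ : 2 ≤ ℓ) (hℓn : ℓ ≤ n)
    {f : Assignment n ℓ} (hf : I.Good f) {c : (algorithm root (capacity n ℓ ε) enc).Config}
    {loc L σ u v pend m mv cm}
    (h : IdleInv I ε f c false loc L σ ((u, v) :: pend) m mv cm) :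
    ∃ c', Reaches ε c c' ∧ ∃ ph' loc' L' m' mv' cm',
      IdleInv I ε f c' ph' loc' L' (σ ++ [(u, v)]) pend m' mv' cm' := by
  have hreq : I.requests = (σ ++ [(u, v)]) ++ pend := by rw [h.requests]; simp
  have hmem : (u, v) ∈ I.requests := by rw [h.requests]; simp
  have hfL := h.tracks.consistent hf
  have hfuv : f u = f v := hf.reach u v (I.requests_adj _ hmem).reachable
  have hcosts : DecentralCosts I f loc L m mv := h.costs
  obtain ⟨w, hw, hmv, hm⟩ := hcosts
  by_cases hL : L u = L v
  · have hs := h.shape.request_same henc h.coll hL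
    exact ⟨_, Reaches.head (h.shape.loc ▸ h.valid) (Reaches.refl (hs.loc ▸ h.valid)),
      false, loc, L, m, mv, cm,
      ⟨hs, hreq, h.tracks.same hL, h.valid, h.coll, h.comm, h.costs⟩⟩
  by_cases hloc : loc u = loc v
  · have hs := h.shape.request_merge henc h.coll hL hloc
    exact ⟨_, Reaches.head (h.shape.loc ▸ h.valid) (Reaches.refl (hs.loc ▸ h.valid)),
      false, loc, relabel L u v, m, mv, cm,
      ⟨hs, hreq, h.tracks.relabel hmem (Or.inl ⟨rfl, rfl⟩), h.valid, h.coll.relabel hloc, h.comm,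
        ⟨w, hw.merge hL hloc, hmv, hm⟩⟩⟩
  have hjoin : ∀ a b, (a = u ∧ b = v ∨ a = v ∧ b = u) →
      (decision (capacity n ℓ ε) I.init loc L u v = some true ∧ a = u ∧ b = v ∨
        decision (capacity n ℓ ε) I.init loc L u v = some false ∧ a = v ∧ b = u) →
      Joins I.init loc L a b → load loc (loc b) + classSize L a ≤ capacity n ℓ ε →
      ∃ c', Reaches ε c c' ∧ ∃ ph' loc' L' m' mv' cm',
        IdleInv I ε f c' ph' loc' L' (σ ++ [(u, v)]) pend m' mv' cm' := by
    intro a b hab hd hj hfit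
    have hLab : L a ≠ L b := by
      rcases hab with ⟨rfl, rfl⟩ | ⟨rfl, rfl⟩
      · exact hL
      · exact Ne.symm hL
    have hlab : loc a ≠ loc b := by
      rcases hab with ⟨rfl, rfl⟩ | ⟨rfl, rfl⟩
      · exact hloc
      · exact Ne.symm hloc
    have hfab : f a = f b := by
      rcases hab with ⟨rfl, rfl⟩ | ⟨rfl, rfl⟩
      · exact hfuv
      · exact hfuv.symm
    have hv' := valid_shift hε h.coll hlab h.valid hfit
    obtain ⟨c', hr, hs⟩ := h.shape.request_join henc h.coll hloc hd h.valid hv'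
    have hnm := numMoved_shift h.coll hlab
    have hpos := classSize_pos L a
    have hcomm := h.comm
    -- The moved piece is nonempty, so two statistics and one message per travelling vertex are at
    -- most three messages per move, and a single move pays for the request.
    refine ⟨c', hr, false, _, _, _, _, _, hs, hreq, h.tracks.relabel hmem hab, hv',
      h.coll.shift, by omega, ⟨_, hw.join hLab hlab hfL hfab hj, ?_, by omega⟩⟩
    rw [Finset.sum_add_distrib, ← hmv, hnm, classSize_eq_card, Finset.card_filter]
  cases hd : decision (capacity n ℓ ε) I.init loc L u v with
  | some b =>
    cases b with
    | true =>
      obtain ⟨hj, hfit⟩ := decision_true hd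
      exact hjoin u v (Or.inl ⟨rfl, rfl⟩) (Or.inl ⟨hd, rfl, rfl⟩) hj hfit
    | false =>
      obtain ⟨hj, hfit⟩ := decision_false hd
      exact hjoin v u (Or.inr ⟨rfl, rfl⟩) (Or.inr ⟨hd, rfl, rfl⟩) hj hfit
  | none =>
    have htr := h.tracks.relabel hmem (Or.inl ⟨rfl, rfl⟩ : u = u ∧ v = v ∨ _)
    obtain ⟨hrc, hrb, hrn⟩ := reset_spec hℓ loc (htr.consistent hf) hf.balanced
    have hv' := hrb.valid (by omega) hε
    obtain ⟨c', hr, hs⟩ := h.shape.request_overload henc h.coll hloc hd h.valid hv' (by omega)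
    have hM : ε * n / ℓ < 8 * numMoved I.init f := by
      rcases decision_none hd with ⟨hj, hfull⟩ | ⟨hj, hfull⟩
      · exact hw.overload hε (by omega) I.init_balanced hL hloc hfL hfuv hj hfull
      · exact hw.overload hε (by omega) I.init_balanced (Ne.symm hL) (Ne.symm hloc) hfL
          hfuv.symm hj hfull
    have hsum := hw.sum_le
    have hle := numMoved_le loc (reset loc (relabel L u v))
    have hcard : (Finset.univ.image (relabel L u v)).card ≤ n :=
      (Finset.card_le_univ _).trans (by simp)
    have hcomm := h.comm
    -- In the base, one `n` is for the rearrangement itself and one for its distance to `init`. The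
    -- 2 + ℓ + 2n messages beyond the carried vertices are at most 4n, hence eight per vertex moved
    -- by `reset`; with the carrying message this gives the factor 9, and the labels are covered by
    -- the summand `n`.
    refine ⟨c', hr, true, _, _, _, _, _, hs, hreq, htr, hv', hrc.of_relabel.relabel
      (hrc u v (by simp [relabel])), by omega,
      ⟨hM, ⟨_, _, _, CentralInv.start (by omega) hrc hrb (by omega)⟩, by omega, by omega⟩⟩

theorem IdleInv.step_central (henc : Function.Injective enc) {I : Instance n ℓ} {ε : ℝ}
    (hε : 0 < ε) (hℓ : 2 ≤ ℓ)
    {f : Assignment n ℓ} (hf : I.Good f) {c : (algorithm root (capacity n ℓ ε) enc).Config}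
    {loc L σ u v pend m mv cm}
    (h : IdleInv I ε f c true loc L σ ((u, v) :: pend) m mv cm) :
    ∃ c', Reaches ε c c' ∧ ∃ ph' loc' L' m' mv' cm',
      IdleInv I ε f c' ph' loc' L' (σ ++ [(u, v)]) pend m' mv' cm' := by
  classical
  have hreq : I.requests = (σ ++ [(u, v)]) ++ pend := by rw [h.requests]; simp
  have hmem : (u, v) ∈ I.requests := by rw [h.requests]; simp
  have hcosts : CentralCosts I ε f loc L m mv := h.costs
  obtain ⟨hM, ⟨prev, R, s, hi⟩, hm, hmn⟩ := hcosts
  by_cases hL : L u = L v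
  · have hs := h.shape.request_same henc h.coll hL
    exact ⟨_, Reaches.head (h.shape.loc ▸ h.valid) (Reaches.refl (hs.loc ▸ h.valid)),
      true, loc, L, m, mv, cm,
      ⟨hs, hreq, h.tracks.same hL, h.valid, h.coll, h.comm, h.costs⟩⟩
  by_cases hloc : loc u = loc v
  · obtain ⟨c', hr, hs⟩ := h.shape.request_merge_central henc h.coll hL hloc h.valid
    -- Nothing moves here; the lost label pays for the message to the root.
    have := card_image_relabel hL
    exact ⟨c', hr, true, loc, relabel L u v, _, mv, cm,
      ⟨hs, hreq, h.tracks.relabel hmem (Or.inl ⟨rfl, rfl⟩), h.valid, h.coll.relabel hloc, h.comm,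
        ⟨hM, ⟨prev, R, s, hi.merge hL hloc⟩, by omega, hmn⟩⟩⟩
  have key : ∀ a b, (a = u ∧ b = v ∨ a = v ∧ b = u) → classSize L a ≤ classSize L b →
      centralPlan (capacity n ℓ ε) ⟨loc, I.init, L⟩ u v =
        replan (capacity n ℓ ε) ⟨loc, I.init, L⟩ a b →
      ∃ c', Reaches ε c c' ∧ ∃ ph' loc' L' m' mv' cm',
        IdleInv I ε f c' ph' loc' L' (σ ++ [(u, v)]) pend m' mv' cm' := by
    intro a b hab hle hplan
    have hLab : L a ≠ L b := by
      rcases hab with ⟨rfl, rfl⟩ | ⟨rfl, rfl⟩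
      · exact hL
      · exact Ne.symm hL
    have hlab : loc a ≠ loc b := by
      rcases hab with ⟨rfl, rfl⟩ | ⟨rfl, rfl⟩
      · exact hloc
      · exact Ne.symm hloc
    have htr := h.tracks.relabel hmem hab
    obtain ⟨hgc, hgb, hgM⟩ := closest_spec I.init (htr.consistent hf) hf.balanced
    have finish : ∀ loc', replan (capacity n ℓ ε) ⟨loc, I.init, L⟩ a b =
          ⟨loc', I.init, relabel L a b⟩ → Valid ε loc' → Consistent (relabel L a b) loc' →
        (∃ prev R s, CentralInv ε I.init loc' (relabel L a b)
          (80 * (numMoved I.init f * Nat.log 2 n) + 2 * n) (numMoved I.init f)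
          (mv + numMoved loc loc') prev R s) →
        ∃ c', Reaches ε c c' ∧ ∃ ph' loc' L' m' mv' cm',
          IdleInv I ε f c' ph' loc' L' (σ ++ [(u, v)]) pend m' mv' cm' := by
      intro loc' hrep hv' hc' hci
      have h1 : loc' a = loc' b := hc' a b (by simp [relabel])
      -- The moves are at least the size of the relabelled class, so there are at most two orders
      -- per move. With the carried vertices and the one message to the root, four messages per move
      -- suffice, also when everything is recomputed.
      have h2 := classSize_le_numMoved h.coll hc'.of_relabel hlab h1 hle
      have hpos := classSize_pos L a
      obtain ⟨c', hr, hs⟩ := h.shape.request_central henc hloc (hplan.trans hrep) h.valid hv'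
        (by omega)
      have h3 := card_image_relabel hLab
      have h4 := card_changed_le (loc := loc) (loc' := loc') (L := L) (a := a) (b := b)
      have hcomm := h.comm
      exact ⟨c', hr, true, _, _, _, _, _, hs, hreq, htr, hv', hc', by omega,
        ⟨hM, hci, by omega, by omega⟩⟩
    by_cases hfit : load loc (loc b) + classSize L a ≤ capacity n ℓ ε
    · exact finish (shift loc L a b) (by simp [replan, hfit])
        (valid_shift hε h.coll hlab h.valid hfit) h.coll.shift ⟨_, _, _, hi.join hLab hlab hle⟩
    · refine finish (closest I.init (relabel L a b)) (by simp [replan, hfit])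
        (hgb.valid (by omega) hε) hgc
        ⟨_, _, _, hi.recompute (by omega) hLab hle ?_ hgc hgb hgM⟩
      rw [le_capacity_iff hε] at hfit
      push_cast at hfit
      linarith
  by_cases hle : classSize L u ≤ classSize L v
  · exact key u v (Or.inl ⟨rfl, rfl⟩) hle (by simp [centralPlan, hle])
  · exact key v u (Or.inr ⟨rfl, rfl⟩) (by omega) (by simp [centralPlan, hle])

theorem IdleInv.exists_final (henc : Function.Injective enc) {I : Instance n ℓ} {ε : ℝ}
    (hε : 0 < ε) (hn : 2 ≤ n) (hℓ : 2 ≤ ℓ) (hℓn : ℓ ≤ n)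
    {f : Assignment n ℓ} (hf : I.Good f) {c : (algorithm root (capacity n ℓ ε) enc).Config}
    {ph loc L σ pend m mv cm} (h : IdleInv I ε f c ph loc L σ pend m mv cm) :
    ∃ c', Reaches ε c c' ∧ ∃ ph' loc' L' m' mv' cm',
      IdleInv I ε f c' ph' loc' L' I.requests [] m' mv' cm' := by
  induction pend generalizing c ph loc L σ m mv cm with
  | nil =>
    obtain rfl : I.requests = σ := by simpa using h.requests
    exact ⟨c, Reaches.refl (h.shape.loc ▸ h.valid), ph, loc, L, m, mv, cm, h⟩
  | cons e pend ih =>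
    obtain ⟨u, v⟩ := e
    have hstep : ∃ c', Reaches ε c c' ∧ ∃ ph' loc' L' m' mv' cm',
        IdleInv I ε f c' ph' loc' L' (σ ++ [(u, v)]) pend m' mv' cm' := by
      cases ph with
      | false => exact h.step_decentral henc hε hn hℓ hℓn hf
      | true => exact h.step_central henc hε hℓ hf
    obtain ⟨c', hr, ph', loc', L', m', mv', cm', h'⟩ := hstep
    obtain ⟨c'', hr', h''⟩ := ih h'
    exact ⟨c'', hr.trans hr', h''⟩

theorem idleInv_initial {I : Instance n ℓ} {ε : ℝ} (hε : 0 < ε) (hℓ : 0 < ℓ)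
    (f : Assignment n ℓ) :
    IdleInv (root := root) (enc := enc) I ε f ((algorithm root (capacity n ℓ ε) enc).initial I)
      false I.init id [] I.requests 0 0 0 where
  shape := by
    refine ⟨fun j => ?_, fun j => rfl, rfl, rfl, rfl, rfl, rfl⟩
    simp only [DistributedAlgorithm.initial, algorithm, canon, Bool.false_eq_true, false_and,
      if_false]
    congr 1
    funext w
    by_cases hw : I.init w = j <;> simp [knowOf, hw]
  requests := rfl
  tracks := I.tracks_id
  valid := I.init_balanced.valid hℓ hε
  coll := fun x y hxy => by rw [show x = y from hxy]
  comm := le_rfl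
  costs := ⟨0, MajorityInv.initial I.init f, by simp, by simp⟩

/-- The outcome of the algorithm. -/
structure Outcome (I : Instance n ℓ) (ε : ℝ) (f : Assignment n ℓ) (m mv cm : ℕ) : Prop where
  comm : cm ≤ mv
  messages : m ≤ 11 * mv
  moves : (mv : ℝ) ≤ 114 * (numMoved I.init f * (ℓ * Real.logb 2 n / ε))
  few : (numMoved I.init f : ℝ) ≤ 1 / 8 * (ε * n / ℓ) →
    (m : ℝ) ≤ 240 * (numMoved I.init f * Real.logb 2 n)

theorem one_le_logb {x : ℕ} (hx : 2 ≤ x) : 1 ≤ Real.logb 2 x := by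
  rw [Real.le_logb_iff_rpow_le (by norm_num) (by exact_mod_cast (by omega : 0 < x))]
  simpa using (by exact_mod_cast hx : (2 : ℝ) ≤ x)

/-- In the centralized phase n < 8Dℓ/ε for D = `numMoved init f`, so in units of Dℓ lg n / ε the
bound is 80 + 16 for the base, 2 for the recomputations and 16 for the potential, 114 in all.
Messages: 9 + 2 = 11 per move, and 3 · 80 = 240 if no overload occurs. -/
theorem IdleInv.outcome {I : Instance n ℓ} {ε : ℝ} (hε : 0 < ε) (hε1 : ε < 1 / 2) (hn : 2 ≤ n)
    (hℓ : 2 ≤ ℓ) {f : Assignment n ℓ} {c : (algorithm root (capacity n ℓ ε) enc).Config}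
    {ph loc L σ pend m mv cm} (h : IdleInv I ε f c ph loc L σ pend m mv cm) :
    Outcome I ε f m mv cm := by
  have hlog : (Nat.log 2 n : ℝ) ≤ Real.logb 2 n := Real.natLog_le_logb n 2
  have hlog1 := one_le_logb hn
  set lg := Real.logb 2 n
  set M : ℝ := ((numMoved I.init f : ℕ) : ℝ)
  have hM0 : 0 ≤ M := Nat.cast_nonneg _
  have hℓ' : (2 : ℝ) ≤ ℓ := by exact_mod_cast hℓ
  have hn' : (2 : ℝ) ≤ n := by exact_mod_cast hn
  have hdiv : 1 ≤ (ℓ : ℝ) / ε := by rw [le_div_iff₀ hε]; linarith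
  have hX : lg ≤ ℓ * lg / ε := by
    rw [mul_div_right_comm]
    nlinarith
  have hMlog : M * Nat.log 2 n ≤ M * lg := by gcongr
  have hMX : M * lg ≤ M * (ℓ * lg / ε) := by gcongr
  have hMX0 : 0 ≤ M * (ℓ * lg / ε) := (by positivity : 0 ≤ M * lg).trans hMX
  cases ph with
  | false =>
    have hcosts : DecentralCosts I f loc L m mv := h.costs
    obtain ⟨w, hw, hmv, hm⟩ := hcosts
    have h1 : (mv : ℝ) ≤ 80 * (M * Nat.log 2 n) := by
      rw [hmv]
      refine (Nat.cast_le.2 hw.sum_le).trans_eq ?_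
      push_cast
      rfl
    have h2 : (m : ℝ) ≤ 3 * mv := by exact_mod_cast hm
    exact ⟨h.comm, by omega, by linarith, fun _ => by linarith⟩
  | true =>
    have hcosts : CentralCosts I ε f loc L m mv := h.costs
    obtain ⟨hM, ⟨prev, R, s, hi⟩, hm, hmn⟩ := hcosts
    refine ⟨h.comm, by omega, ?_, fun hle => ?_⟩
    · have h1 := hi.moves_bound (by omega) (by omega) hε
      push_cast at h1
      have h2 : (n : ℝ) ≤ 8 * (M * (ℓ / ε)) := by
        have h3 : ε * n / ℓ < 8 * M := hM
        rw [div_lt_iff₀ (by linarith)] at h3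
        rw [mul_div_assoc', mul_div_assoc', le_div_iff₀ hε]
        linarith
      have h3 : (n : ℝ) * lg ≤ 8 * (M * (ℓ * lg / ε)) := by
        calc (n : ℝ) * lg ≤ 8 * (M * (ℓ / ε)) * lg := by gcongr
          _ = _ := by ring
      have h4 : (n : ℝ) ≤ n * lg := by nlinarith
      have h5 : (n : ℝ) * Nat.log 2 n ≤ n * lg := by gcongr
      have h6 : M * (ℓ * Nat.log 2 n / ε) ≤ M * (ℓ * lg / ε) := by gcongr
      linarith
    -- For so small a distance the overload that opened this phase could not have occurred.
    · exfalso
      have : ε * n / ℓ < 8 * M := hM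
      linarith

theorem DistributedAlgorithm.Config.iterate_next_of_finished {A : DistributedAlgorithm n ℓ B}
    {c : A.Config} (h : c.Finished) (t : ℕ) : DistributedAlgorithm.Config.next^[t] c = c := by
  refine Function.iterate_fixed ?_ t
  rw [DistributedAlgorithm.Config.next, if_pos h.1]
  split
  · rfl
  · rename_i h'
    rw [h.2] at h'
    cases h'

theorem algorithm_spec (henc : Function.Injective enc) {ε : ℝ} (hε : 0 < ε) (hε1 : ε < 1 / 2)
    (hn : 2 ≤ n) (hℓ : 2 ≤ ℓ) (hℓn : ℓ ≤ n) (I : Instance n ℓ) {f : Assignment n ℓ}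
    (hf : I.Good f) :
    (∀ t, Valid ε ((algorithm root (capacity n ℓ ε) enc).run I t).loc) ∧
      ∃ T, ((algorithm root (capacity n ℓ ε) enc).run I T).Finished ∧
        I.IsPerfectPartitioning ((algorithm root (capacity n ℓ ε) enc).run I T).loc ∧
        Outcome I ε f ((algorithm root (capacity n ℓ ε) enc).run I T).messages
          ((algorithm root (capacity n ℓ ε) enc).run I T).moves
          ((algorithm root (capacity n ℓ ε) enc).run I T).comm := by
  obtain ⟨c', ⟨T, hT, hv⟩, ph, loc, L, m, mv, cm, h⟩ :=
    (idleInv_initial (root := root) (enc := enc) (I := I) hε (by omega) f).exists_final henc hε hn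
      hℓ hℓn hf
  have hfin : c'.Finished := ⟨h.shape.idle, h.shape.pending⟩
  have hrun : (algorithm root (capacity n ℓ ε) enc).run I T = c' := hT
  refine ⟨fun t => ?_, T, ?_⟩
  · rcases le_total t T with ht | ht
    · exact hv t ht
    · obtain ⟨s, rfl⟩ := Nat.exists_eq_add_of_le' ht
      have : (algorithm root (capacity n ℓ ε) enc).run I (s + T) = c' := by
        rw [DistributedAlgorithm.run, Function.iterate_add_apply, hT,
          DistributedAlgorithm.Config.iterate_next_of_finished hfin]
      rw [this, h.shape.loc]
      exact h.valid
  · rw [hrun, h.shape.loc, h.shape.messages, h.shape.moves, h.shape.comm]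
    exact ⟨hfin, I.perfect_of_valid (by omega) hε1 h.valid fun x y hxy =>
      h.coll x y (h.tracks.reachable hxy), h.outcome hε hε1 hn hℓ⟩

end Analysis
end OnlinePartition

/-! ### Comparison with the offline solution -/

theorem mainTheorem4 :
    ∃ (B : ℕ) (c C : ℝ) (K : ℝ → ℝ), 0 < c ∧ 0 < C ∧
      ∀ (n ℓ : ℕ) (ε : ℝ), 2 ≤ ℓ → 0 < n → ℓ ∣ n → 0 < ε → ε < 1 / 2 →
        ∃ A : OnlinePartition.DistributedAlgorithm n ℓ B,
          ∀ I : OnlinePartition.Instance n ℓ,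
            (∀ t, OnlinePartition.Valid ε (A.run I t).loc) ∧
            ∃ T, (A.run I T).Finished ∧
              I.IsPerfectPartitioning (A.run I T).loc ∧
              (∀ (α : ℝ), 1 < α →
                ∀ OFF : OnlinePartition.OfflineSchedule I ε, OFF.IsOptimal α →
                  (A.run I T).cost α ≤
                    C * (ℓ * Real.logb 2 n * Real.logb 2 ℓ / ε) * OFF.cost α ∧
                  ((OFF.moves : ℝ) ≤ c * (ε * n / (ℓ * Real.logb 2 ℓ)) →
                    ((A.run I T).messages : ℝ) ≤ C * (OFF.moves * Real.logb 2 n)) ∧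
                  (c * (ε * n / (ℓ * Real.logb 2 ℓ)) < (OFF.moves : ℝ) →
                    ((A.run I T).messages : ℝ) ≤
                      C * ((ℓ : ℝ) ^ 2 * Real.logb 2 n / ε + n * Real.logb 2 n +
                        OFF.moves * ℓ * Real.logb 2 n / ε))) ∧
              (∀ a : ℝ, 0 < a → (ℓ : ℝ) ≤ a * Real.sqrt (ε * n) →
                ((A.run I T).messages : ℝ) ≤ K a * (A.run I T).moves) := by
  open OnlinePartition in
  -- 14 is the exponent of the encoding; 1/8 keeps the first message bound below the overload
  -- threshold; 1254 = 11 · 114 converts the bound on moves into one on messages.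
  refine ⟨14, 1 / 8, 1254, fun _ => 11, by norm_num, by norm_num, ?_⟩
  intro n ℓ ε hℓ hn hdvd hε hε1
  have hℓn : ℓ ≤ n := Nat.le_of_dvd hn hdvd
  obtain ⟨enc, henc⟩ := exists_encoding (n := n) (ℓ := ℓ) (by omega) hℓn
  refine ⟨algorithm ⟨0, by omega⟩ (capacity n ℓ ε) enc, fun I => ?_⟩
  -- The algorithm is fixed before `f` is chosen. Minimality of `f` makes its distance a lower bound
  -- for the moves of every offline schedule.
  obtain ⟨f, hf, hmin⟩ := exists_closest I.init (I.exists_good hn)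
  obtain ⟨hvalid, T, hfin, hperf, hout⟩ := algorithm_spec (root := ⟨0, by omega⟩) henc hε hε1
    (by omega) hℓ hℓn I hf
  have hmsg : (((algorithm ⟨0, by omega⟩ (capacity n ℓ ε) enc).run I T).messages : ℝ) ≤
      11 * ((algorithm ⟨0, by omega⟩ (capacity n ℓ ε) enc).run I T).moves := by
    exact_mod_cast hout.messages
  refine ⟨hvalid, T, hfin, hperf, ?_, fun a _ _ => hmsg⟩
  intro α hα OFF _
  set c := (algorithm ⟨0, by omega⟩ (capacity n ℓ ε) enc).run I T
  have hMO : numMoved I.init f ≤ OFF.moves :=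
    (hmin _ OFF.final.good).trans OFF.numMoved_le_moves
  have hMO' : (numMoved I.init f : ℝ) ≤ OFF.moves := by exact_mod_cast hMO
  have hM0 : (0 : ℝ) ≤ numMoved I.init f := Nat.cast_nonneg _
  have hlgn : 1 ≤ Real.logb 2 n := one_le_logb (by omega)
  have hlgl : 1 ≤ Real.logb 2 ℓ := one_le_logb hℓ
  have hℓ' : (2 : ℝ) ≤ ℓ := by exact_mod_cast hℓ
  have hX0 : 0 ≤ ℓ * Real.logb 2 n / ε := by positivity
  have hmoves := hout.moves
  refine ⟨?_, fun h => ?_, fun _ => ?_⟩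
  · have hcm : (c.comm : ℝ) ≤ c.moves := by exact_mod_cast hout.comm
    have hmv0 : (0 : ℝ) ≤ c.moves := Nat.cast_nonneg _
    have hcomm0 : (0 : ℝ) ≤ OFF.comm := Nat.cast_nonneg _
    have hX : ℓ * Real.logb 2 n / ε ≤ ℓ * Real.logb 2 n * Real.logb 2 ℓ / ε := by
      exact div_le_div_of_nonneg_right (le_mul_of_one_le_right (by positivity) hlgl) hε.le
    calc c.cost α = c.comm + α * c.moves := rfl
      -- Paid requests are at most the moves, and α > 1.
      _ ≤ 2 * α * c.moves := by nlinarith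
      _ ≤ 2 * α * (114 * (numMoved I.init f * (ℓ * Real.logb 2 n / ε))) := by gcongr
      _ = 228 * (ℓ * Real.logb 2 n / ε) * (α * numMoved I.init f) := by ring
      _ ≤ 1254 * (ℓ * Real.logb 2 n * Real.logb 2 ℓ / ε) * (α * OFF.moves) := by
        gcongr
        norm_num
      _ ≤ 1254 * (ℓ * Real.logb 2 n * Real.logb 2 ℓ / ε) * OFF.cost α := by
        have h0 : 0 ≤ ℓ * Real.logb 2 n * Real.logb 2 ℓ / ε := hX0.trans hX
        refine mul_le_mul_of_nonneg_left ?_ (by positivity)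
        unfold OfflineSchedule.cost
        linarith
  · have h1 : ε * n / (ℓ * Real.logb 2 ℓ) ≤ ε * n / ℓ := by
      gcongr
      exact le_mul_of_one_le_right (by positivity) hlgl
    have h2 := hout.few (by linarith)
    have h3 : (numMoved I.init f : ℝ) * Real.logb 2 n ≤ OFF.moves * Real.logb 2 n := by gcongr
    have h4 : 0 ≤ (numMoved I.init f : ℝ) * Real.logb 2 n := by positivity
    linarith
  · have h1 : (numMoved I.init f : ℝ) * (ℓ * Real.logb 2 n / ε) ≤
        OFF.moves * ℓ * Real.logb 2 n / ε := by
      calc _ ≤ (OFF.moves : ℝ) * (ℓ * Real.logb 2 n / ε) := by gcongr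
        _ = _ := by ring
    have h2 : 0 ≤ (ℓ : ℝ) ^ 2 * Real.logb 2 n / ε := by positivity
    have h3 : 0 ≤ (n : ℝ) * Real.logb 2 n := by positivity
    linarith
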